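/- Let $R$ be a Dedekind domain whose ideal class group $\mathrm{Cl}(R)$ is a torsion group, and let $\mathcal O\subsetneq R$ be an order, i.e. a proper subring with the same quotient field as $R$ such that $R$ is a finitely generated $\mathcal O$-module. Let $\mathfrak f=\{x\in R : xR\subseteq\mathcal O\}$ be its conductor. Suppose that $R/\mathfrak f$ is finite and that every class of $\mathrm{Cl}(R)$ contains a nonzero prime ideal of $R$ coprime to $\mathfrak f$. A homomorphism $\theta:H\to B$ of commutative cancellative monoids is a transfer homomorphism if $B=\theta(H)B^\times$, $\theta^{-1}(B^\times)=H^\times$, and whenever $\theta(u)=bc$ with $u\in H$ and $b,c\in B$, there are $v,w\in H$ with $u=vw$, $\theta(v)\in bB^\times$ and $\theta(w)\in cB^\times$. A commutative cancellative monoid is Krull if it is completely integrally closed and satisfies the ascending chain condition on $v$-ideals (divisorial ideals). Suppose that $\mathcal O$ is transfer Krull, i.e. there is a transfer homomorphism from the multiplicative monoid $\mathcal O\setminus\{0\}$ to a Krull monoid. If $|\mathrm{Cl}(R)|\neq 2$, then $\mathrm{Pic}(\mathcal O)\cong\mathrm{Cl}(R)$; more precisely, the canonical homomorphism $\mathrm{Pic}(\mathcal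 O)\to\mathrm{Cl}(R)$, $[I]\mapsto[IR]$, is an isomorphism. Moreover, every element of $\mathrm{Reg}_{\mathfrak f}(R)=\{a\in R : a+\mathfrak f\in (R/\mathfrak f)^\times\}$ is of the form $b\varepsilon$ with $b\in\mathcal O$ and $\varepsilon\in R^\times$. -/

import Mathlib

open scoped nonZeroDivisors

universe u v

namespace TransferKrull

section Monoids

/- Monoids are commutative. The Krull monoids and the monoids of nonzero elements of domains to which
the following notions are applied are cancellative, so they embed in their quotient groups. -/

/-- A transfer homomorphism `θ : H → B` of commutative monoids: `B = θ(H) Bˣ`, `θ⁻¹(Bˣ) = Hˣ`,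
and every factorization of `θ u` in `B` lifts, up to associates, to a factorization of `u`. -/
structure IsTransferHom {H : Type u} {B : Type v} [CommMonoid H] [CommMonoid B]
    (θ : H →* B) : Prop where
  exists_associated : ∀ b : B, ∃ h : H, Associated (θ h) b
  isUnit_iff : ∀ h : H, IsUnit (θ h) ↔ IsUnit h
  exists_lift : ∀ (u : H) (b c : B), θ u = b * c →
    ∃ v w : H, u = v * w ∧ Associated (θ v) b ∧ Associated (θ w) c

variable (H : Type u) [CommMonoid H]

/-- The image of `H` in its quotient group `q(H)`. -/
def carrier : Submonoid (Algebra.GrothendieckGroup H) :=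
  MonoidHom.mrange (Algebra.GrothendieckGroup.of (M := H))

/-- The complete integral closure of `H` in `q(H)`: all `x` such that for some `c ∈ H` one has
`c xⁿ ∈ H` for all positive integers `n`. -/
def completeIntegralClosure : Set (Algebra.GrothendieckGroup H) :=
  {x | ∃ c ∈ carrier H, ∀ n : ℕ, 0 < n → c * x ^ n ∈ carrier H}

/-- `X⁻¹ = (H : X) = {x ∈ q(H) : x X ⊆ H}`. -/
def dual (X : Set (Algebra.GrothendieckGroup H)) : Set (Algebra.GrothendieckGroup H) :=
  {x | ∀ y ∈ X, x * y ∈ carrier H}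

/-- A `v`-ideal (divisorial ideal) of `H`: a subset `I ⊆ H` with `(I⁻¹)⁻¹ = I`. -/
def IsVIdeal (I : Set (Algebra.GrothendieckGroup H)) : Prop :=
  I ⊆ carrier H ∧ dual H (dual H I) = I

/-- A Krull monoid: completely integrally closed, with the ascending chain condition on
`v`-ideals. -/
structure IsKrull : Prop where
  completelyIntegrallyClosed : completeIntegralClosure H = carrier H
  acc_vIdeals : ∀ I : ℕ → Set (Algebra.GrothendieckGroup H),
    (∀ n, IsVIdeal H (I n)) → Monotone I → ∃ N, ∀ n, N ≤ n → I n = I N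

/-- `H` is transfer Krull if it admits a transfer homomorphism to some commutative cancellative
Krull monoid (in an arbitrary universe `v`). -/
def IsTransferKrull : Prop :=
  ∃ (B : Type v) (_ : CancelCommMonoid B), IsKrull B ∧ ∃ θ : H →* B, IsTransferHom θ

end Monoids

section Orders

variable {R : Type u} [CommRing R]

/-- An order in the domain `R`: a subring `O` with the same quotient field as `R` such that `R` is
a finitely generated `O`-module. -/
structure IsOrder [IsDomain R] (O : Subring R) : Prop where
  isFractionRing : IsFractionRing O (FractionRing R)
  finite : Module.Finite O R

/-- The conductor `{x ∈ R : x R ⊆ O}` of `O` in `R`. -/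
def conductor (O : Subring R) : Ideal R where
  carrier := {x | ∀ r : R, x * r ∈ O}
  add_mem' := fun hx hy r => by
    rw [add_mul]
    exact O.add_mem (hx r) (hy r)
  zero_mem' := fun r => by
    rw [zero_mul]
    exact O.zero_mem
  smul_mem' := fun c x hx r => by
    have h := hx (c * r)
    rwa [← mul_assoc, mul_comm x c] at h

/-- The conductor is the greatest ideal of `R` contained in `O`. -/
theorem le_conductor_iff (O : Subring R) (I : Ideal R) :
    I ≤ conductor O ↔ (I : Set R) ⊆ O := by
  constructor
  · intro h x hx
    have := h hx 1
    rwa [mul_one] at this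
  · intro h x hx r
    exact h (I.mul_mem_right r hx)

/-- `Reg_𝔣(R)`: the elements of `R` that are units modulo the conductor `𝔣` of `O`. -/
def regularElements (O : Subring R) : Submonoid R :=
  (IsUnit.submonoid (R ⧸ conductor O)).comap (Ideal.Quotient.mk (conductor O))

end Orders

end TransferKrull

/-!
# Transfer Krull orders in Dedekind domains

Let `𝔣` be the conductor of `O`. Ideals of `R` coprime to `𝔣` are products of primes coprime to `𝔣`,
and by contraction they correspond to invertible ideals of `O`. The kernel of `Pic O → Cl R`
measures which regular elements of `R` are not associated to elements of `O`
(`extendedHom_injective`), so everything reduces to the last assertion of the theorem.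

Let `θ : O⁰ → B` be a transfer homomorphism to a Krull monoid. Since `B` is root closed, `θ` extends
to all regular elements of `R` (`exists_extension`): for `0 ≠ x ∈ 𝔣` and `r ^ n ∈ O`, the `n`-th
power of `θ x` divides that of `θ (x r)`. From here on the argument is about multisets of primes of
`R`, and is carried out for an abstract `TransferSystem`: `H` is the set of multisets of primes
whose product is generated by an element of `O`, and the goal is that `H` contains every multiset
of trivial class (`mem_of_cls_eq_one`).

* If `a` has trivial class, then `n a ∈ H` for some `n`, and lifting `θ (n a) = θ(a) ^ n` gives
  `n` members of `H` with the same image as `a` and sum `n a` (`exists_lift_nsmul`). For `a = m P`,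
  with `m = ord P` the order of the class of `P`, this forces `m P ∈ H`.
* The elements `rep P = θ (m P)` are absolutely irreducible, and products of them determine the
  factors (`map_rep_eq_of_prod_eq`). So `θ a` is described by rational weights, to which `P`
  contributes `1 / ord P` at `rep P` (`weight_eq_of_θ_eq`). If the primes in `a` have distinct
  images under `rep`, then `a` is the only element over `θ a`, whence `a ∈ H` (`mem_of_injOn`).
* Root-closedness implies that primes of the same order with the same image under `rep` lie in the
  same class (`cl_eq_of_rep_eq`). Hence pairs of primes of opposite class of order at least three
  lie in `H`.
* Let `P Q T` be of trivial class, where primes in the same class are equal. Comparison of weights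
  shows that `P Q T ∈ H` unless all three primes have the same image under `rep`. In that case the
  sum of the `1 / ord` is an integer, so that the orders are all three, which is harmless, or one of
  them is two, and then the triple of primes in the inverse classes is not exceptional
  (`triple_mem_of_inj`).
* If `Cl R` does not have two elements, a class `c` of order two is part of such a triple `c`, `d`,
  `(c d)⁻¹`. It follows that primes in the same class are interchangeable (`cons_mem_of_cl_eq`);
  then all triples of trivial class are in `H`, and an induction concludes.
-/

namespace TransferKrull

section Combinatorics

open Multiset

/-! ### Transfer systems and lifting -/

/-- The combinatorial shadow of a transfer homomorphism on an order. The elements of `ι` are the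
nonzero prime ideals coprime to the conductor, `cl` sends a prime to its class, a multiset of primes
stands for the product of its members, and `H` consists of the multisets whose product is generated
by an element of the order. On multisets of trivial class, `θ` is a homomorphism to a reduced
cancellative monoid in which `yⁿ ∣ xⁿ` implies `y ∣ x`, and its restriction to `H` is a transfer
homomorphism. Values of `θ` at multisets of nontrivial class are irrelevant. -/
structure TransferSystem (ι C B : Type*) [CommGroup C] [CancelCommMonoid B] where
  cl : ι → C
  cl_surjective : Function.Surjective cl
  torsion : IsMulTorsion C
  H : AddSubmonoid (Multiset ι)
  class_eq_one : ∀ {S}, S ∈ H → (S.map cl).prod = 1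
  mem_of_add_mem : ∀ {S T}, S ∈ H → S + T ∈ H → T ∈ H
  exists_nsmul_mem : ∀ {S : Multiset ι}, (S.map cl).prod = 1 → ∃ n, 0 < n ∧ n • S ∈ H
  θ : Multiset ι → B
  θ_add : ∀ {S T}, (S.map cl).prod = 1 → (T.map cl).prod = 1 → θ (S + T) = θ S * θ T
  eq_zero_of_θ_eq_one : ∀ {S}, S ∈ H → θ S = 1 → S = 0
  exists_lift : ∀ {S b c}, S ∈ H → θ S = b * c →
    ∃ v ∈ H, ∃ w ∈ H, S = v + w ∧ θ v = b ∧ θ w = c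
  exists_eq_mul_of_pow : ∀ {n : ℕ} {x y z : B}, n ≠ 0 → x ^ n = y ^ n * z → ∃ b, x = y * b
  eq_one_of_mul_eq_one : ∀ {x y : B}, x * y = 1 → x = 1

namespace TransferSystem

variable {ι C B : Type*} [CommGroup C] [CancelCommMonoid B] (D : TransferSystem ι C B)

/-- The class of (the ideal represented by) a multiset of primes. -/
def cls (S : Multiset ι) : C := (S.map D.cl).prod

@[simp] lemma cls_zero : D.cls 0 = 1 := by simp [cls]
@[simp] lemma cls_add (S T : Multiset ι) : D.cls (S + T) = D.cls S * D.cls T := by simp [cls]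
@[simp] lemma cls_cons (P : ι) (S : Multiset ι) : D.cls (P ::ₘ S) = D.cl P * D.cls S := by
  simp [cls]
@[simp] lemma cls_singleton (P : ι) : D.cls {P} = D.cl P := by simp [cls]
@[simp] lemma cls_nsmul (n : ℕ) (S : Multiset ι) : D.cls (n • S) = D.cls S ^ n := by
  simp [cls, map_nsmul, prod_nsmul]
@[simp] lemma cls_replicate (n : ℕ) (P : ι) : D.cls (replicate n P) = D.cl P ^ n := by
  simp [cls]

variable {D}

lemma cls_of_mem {S : Multiset ι} (h : S ∈ D.H) : D.cls S = 1 := D.class_eq_one h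

lemma θ_zero : D.θ 0 = 1 := by
  have h := D.θ_add (S := 0) (T := 0) (by simp) (by simp)
  rw [add_zero] at h
  exact (mul_eq_left (a := D.θ 0)).1 h.symm

lemma θ_nsmul {S : Multiset ι} (h : D.cls S = 1) (n : ℕ) : D.θ (n • S) = D.θ S ^ n := by
  induction n with
  | zero => simp [θ_zero]
  | succ n ih => rw [succ_nsmul, D.θ_add (by change D.cls _ = 1; simp [h]) h, ih, pow_succ]

lemma ne_zero_of_θ_ne_one {S : Multiset ι} (h : D.θ S ≠ 1) : S ≠ 0 := by
  rintro rfl; exact h θ_zero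

lemma exists_lift_pow {b : B} : ∀ (n : ℕ) {S : Multiset ι}, S ∈ D.H → D.θ S = b ^ n →
    ∃ l : Multiset (Multiset ι), card l = n ∧ l.sum = S ∧ ∀ v ∈ l, v ∈ D.H ∧ D.θ v = b
  | 0, S, hS, h => ⟨0, by simp, by simp [D.eq_zero_of_θ_eq_one hS (by simpa using h)], by simp⟩
  | n + 1, S, hS, h => by
    obtain ⟨v, hv, w, hw, rfl, h1, h2⟩ := D.exists_lift hS (h.trans (pow_succ' b n))
    obtain ⟨l, hl, rfl, hl'⟩ := exists_lift_pow n hw h2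
    refine ⟨v ::ₘ l, by simp [hl], by simp, ?_⟩
    intro x hx
    rcases mem_cons.1 hx with rfl | hx
    exacts [⟨hv, h1⟩, hl' x hx]

/-- A power of an element `a` of trivial class lies in `H`, and `θ` of it is a power of `θ a`;
lifting the latter gives members of `H` with the same image as `a`. -/
lemma exists_lift_nsmul {a : Multiset ι} (ha : D.cls a = 1) :
    ∃ l : Multiset (Multiset ι), 0 < card l ∧ l.sum = card l • a ∧
      ∀ v ∈ l, v ∈ D.H ∧ D.θ v = D.θ a := by
  obtain ⟨n, hn, h⟩ := D.exists_nsmul_mem ha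
  obtain ⟨l, rfl, h2, h3⟩ := exists_lift_pow n h (θ_nsmul ha n)
  exact ⟨l, hn, h2, h3⟩

lemma θ_ne_one {a : Multiset ι} (ha : D.cls a = 1) (h0 : a ≠ 0) : D.θ a ≠ 1 := by
  intro h
  obtain ⟨n, hn, hna⟩ := D.exists_nsmul_mem ha
  have := D.eq_zero_of_θ_eq_one hna (by rw [θ_nsmul ha, h, one_pow])
  rw [← card_eq_zero, card_nsmul, mul_eq_zero, card_eq_zero] at this
  exact this.elim hn.ne' h0

lemma mem_of_mem_of_sum_eq {l : Multiset (Multiset ι)} {a v : Multiset ι} {n : ℕ}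
    (hl : l.sum = n • a) (hv : v ∈ l) {Q : ι} (hQ : Q ∈ v) : Q ∈ a := by
  have : Q ∈ l.sum := by
    obtain ⟨l, rfl⟩ := exists_cons_of_mem hv
    simp [hQ]
  exact mem_of_mem_nsmul (hl ▸ this)

lemma exists_mem_θ_eq {a : Multiset ι} (ha : D.cls a = 1) {P : ι} (hP : P ∈ a) :
    ∃ v ∈ D.H, D.θ v = D.θ a ∧ P ∈ v ∧ ∀ Q ∈ v, Q ∈ a := by
  obtain ⟨l, hl0, hl, hlv⟩ := exists_lift_nsmul ha
  have : P ∈ l.sum := by rw [hl]; exact mem_nsmul.2 ⟨hl0.ne', hP⟩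
  have : ∃ v ∈ l, P ∈ v := by
    by_contra! h
    clear hl hl0 hlv
    induction l using Multiset.induction with
    | empty => simp at this
    | cons v l ih =>
      rw [sum_cons, mem_add] at this
      rcases this with h1 | h1
      · exact h v (mem_cons_self _ _) h1
      · exact ih h1 fun w hw => h w (mem_cons_of_mem hw)
  obtain ⟨v, hv, hPv⟩ := this
  exact ⟨v, (hlv v hv).1, (hlv v hv).2, hPv, fun Q hQ => mem_of_mem_of_sum_eq hl hv hQ⟩

lemma exists_mem_θ_eq_card_le {a : Multiset ι} (ha : D.cls a = 1) :
    ∃ v ∈ D.H, D.θ v = D.θ a ∧ card v ≤ card a ∧ ∀ Q ∈ v, Q ∈ a := by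
  obtain ⟨l, hl0, hl, hlv⟩ := exists_lift_nsmul ha
  have : ∃ v ∈ l, card v ≤ card a := by
    by_contra! h
    have h1 : card (l.map card) • (card a + 1) ≤ (l.map card).sum :=
      card_nsmul_le_sum (by simpa using fun v hv => h v hv)
    have h2 : (l.map card).sum = card l * card a := by
      have := congrArg card hl
      rw [card_nsmul] at this
      rw [← this]
      exact (map_multiset_sum (cardHom (α := ι)) l).symm
    rw [h2, card_map, smul_eq_mul] at h1
    nlinarith
  obtain ⟨v, hv, hc⟩ := this
  exact ⟨v, (hlv v hv).1, (hlv v hv).2, hc, fun Q hQ => mem_of_mem_of_sum_eq hl hv hQ⟩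

variable (D) in
/-- The order of the class of a prime. -/
noncomputable def ord (P : ι) : ℕ := orderOf (D.cl P)

lemma ord_pos (P : ι) : 0 < D.ord P := (D.torsion (D.cl P)).orderOf_pos

/-- Of the members of `H` with the same image as `P ^ ord P` whose sum is `n (ord P) P`, the average
size is `ord P`, and each has size a positive multiple of `ord P`. -/
lemma replicate_ord_mem (P : ι) : replicate (D.ord P) P ∈ D.H := by
  have h1 : D.cls (replicate (D.ord P) P) = 1 := by simp [ord, pow_orderOf_eq_one]
  obtain ⟨v, hv, hθ, hc, hQ⟩ := exists_mem_θ_eq_card_le h1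
  have hv' : v = replicate (card v) P :=
    eq_replicate.2 ⟨rfl, fun Q h => (mem_replicate.1 (hQ Q h)).2⟩
  have hv0 : v ≠ 0 := by
    apply ne_zero_of_θ_ne_one (D := D)
    rw [hθ]
    apply θ_ne_one h1
    rw [Ne, ← card_eq_zero, card_replicate]
    exact (ord_pos P).ne'
  have hd : D.ord P ∣ card v := by
    apply orderOf_dvd_of_pow_eq_one
    rw [← cls_replicate, ← hv', cls_of_mem hv]
  have : D.ord P = card v := le_antisymm
    (Nat.le_of_dvd (card_pos.2 hv0) hd) (by simpa using hc)
  rw [this, ← hv']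
  exact hv

lemma replicate_mem_iff {k : ℕ} {P : ι} : replicate k P ∈ D.H ↔ D.ord P ∣ k := by
  constructor
  · intro h
    apply orderOf_dvd_of_pow_eq_one
    rw [← cls_replicate, cls_of_mem h]
  · rintro ⟨j, rfl⟩
    rw [mul_comm, ← nsmul_replicate]
    exact nsmul_mem (replicate_ord_mem P) j

variable (D) in
/-- The image under `θ` of the least power of a prime whose class is trivial. -/
noncomputable def rep (P : ι) : B := D.θ (replicate (D.ord P) P)

lemma θ_replicate_mul (k : ℕ) (P : ι) : D.θ (replicate (k * D.ord P) P) = D.rep P ^ k := by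
  rw [← nsmul_replicate, θ_nsmul (cls_of_mem (replicate_ord_mem P)), rep]

lemma rep_pow_eq_one {P : ι} {k : ℕ} (h : D.rep P ^ k = 1) : k = 0 := by
  rw [← θ_replicate_mul] at h
  have := D.eq_zero_of_θ_eq_one (replicate_mem_iff.2 (dvd_mul_left _ _)) h
  rw [← card_eq_zero, card_replicate, mul_eq_zero] at this
  exact this.resolve_right (ord_pos P).ne'

lemma rep_pow_injective {P : ι} {i j : ℕ} (h : D.rep P ^ i = D.rep P ^ j) : i = j := by
  wlog hij : i ≤ j
  · exact (this h.symm (le_of_not_ge hij)).symm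
  obtain ⟨k, rfl⟩ := Nat.exists_eq_add_of_le hij
  rw [pow_add] at h
  rw [rep_pow_eq_one ((mul_eq_left).1 h.symm), add_zero]

/-- `rep P` is an absolutely irreducible element: every factorization of one of its powers consists
of powers of `rep P`. -/
lemma rep_pow_eq_mul {P : ι} {k : ℕ} {b c : B} (h : D.rep P ^ k = b * c) :
    ∃ i j, i + j = k ∧ b = D.rep P ^ i ∧ c = D.rep P ^ j := by
  rw [← θ_replicate_mul] at h
  obtain ⟨v, hv, w, hw, hvw, rfl, rfl⟩ :=
    D.exists_lift (replicate_mem_iff.2 (dvd_mul_left _ _)) h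
  obtain ⟨i, -, rfl⟩ := le_replicate_iff.1 (hvw ▸ Multiset.le_add_right v w)
  obtain ⟨j, -, rfl⟩ := le_replicate_iff.1 (hvw ▸ Multiset.le_add_left w (replicate i P))
  obtain ⟨i, rfl⟩ := replicate_mem_iff.1 hv
  obtain ⟨j, rfl⟩ := replicate_mem_iff.1 hw
  rw [mul_comm _ i, mul_comm _ j] at *
  refine ⟨i, j, ?_, θ_replicate_mul _ _, θ_replicate_mul _ _⟩
  have := congrArg card hvw
  simp only [card_replicate, card_add] at this
  rw [← add_mul] at this
  exact (Nat.eq_of_mul_eq_mul_right (ord_pos P) this).symm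

lemma rep_eq_rep_of_pow_eq_mul {P Q : ι} {k : ℕ} {c : B} (h : D.rep P ^ k = D.rep Q * c) :
    D.rep Q = D.rep P := by
  obtain ⟨i, -, -, hi, -⟩ := rep_pow_eq_mul h
  cases i with
  | zero => exact absurd (rep_pow_eq_one (k := 1) (by simpa using hi)) one_ne_zero
  | succ i =>
    have h1 : D.rep Q ^ 1 = D.rep P * D.rep P ^ i := by rw [pow_one, hi, pow_succ']
    obtain ⟨r, s, hrs, h2, h3⟩ := rep_pow_eq_mul h1
    have hr : r ≠ 0 := by
      rintro rfl
      exact absurd (rep_pow_eq_one (k := 1) (by simpa using h2)) one_ne_zero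
    obtain rfl : r = 1 := by omega
    simpa using h2.symm

variable (D) in
/-- Replaces each prime `P` of a multiset by its power `P ^ ord P`. -/
noncomputable def expand (s : Multiset ι) : Multiset ι := s.bind fun P => replicate (D.ord P) P

lemma expand_mem (s : Multiset ι) : D.expand s ∈ D.H := by
  induction s using Multiset.induction with
  | empty => simp [expand, D.H.zero_mem]
  | cons P s ih =>
    rw [expand, cons_bind]
    exact D.H.add_mem (replicate_ord_mem P) ih

lemma θ_expand (s : Multiset ι) : D.θ (D.expand s) = (s.map D.rep).prod := by
  induction s using Multiset.induction with
  | empty => simp [expand, θ_zero]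
  | cons P s ih =>
    rw [map_cons, prod_cons, ← ih, expand, cons_bind]
    exact D.θ_add (cls_of_mem (replicate_ord_mem P)) (cls_of_mem (expand_mem s))

lemma mem_of_mem_expand {s : Multiset ι} {P : ι} (h : P ∈ D.expand s) : P ∈ s := by
  obtain ⟨Q, hQ, h⟩ := mem_bind.1 h
  rwa [(mem_replicate.1 h).2]

/-- The elements `rep P` generate a free submonoid: the cone spanned by the image of `θ` is
simplicial. -/
lemma map_rep_eq_of_prod_eq : ∀ {t s : Multiset ι},
    (s.map D.rep).prod = (t.map D.rep).prod → s.map D.rep = t.map D.rep := by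
  intro t
  induction t using Multiset.induction with
  | empty =>
    intro s h
    have h1 : D.expand s = 0 := D.eq_zero_of_θ_eq_one (expand_mem s) (by rw [θ_expand, h]; simp)
    obtain rfl : s = 0 := by
      apply eq_zero_of_forall_notMem
      intro P hP
      have : P ∈ D.expand s := mem_bind.2 ⟨P, hP, mem_replicate.2 ⟨(ord_pos P).ne', rfl⟩⟩
      simp [h1] at this
    rfl
  | cons P' t ih =>
    intro s h
    rw [map_cons, prod_cons, ← θ_expand] at h
    obtain ⟨v, hv, w, hw, hvw, hθv, -⟩ := D.exists_lift (expand_mem s) h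
    have hv0 : v ≠ 0 := by
      apply ne_zero_of_θ_ne_one (D := D)
      rw [hθv]
      intro h1
      exact absurd (rep_pow_eq_one (k := 1) (by simpa using h1)) one_ne_zero
    obtain ⟨P, hP⟩ := exists_mem_of_ne_zero hv0
    have hPs : P ∈ s := mem_of_mem_expand (hvw ▸ mem_add.2 (Or.inl hP))
    have hle : replicate (D.ord P) P ≤ D.ord P • v := by
      classical
      rw [← le_count_iff_replicate_le, count_nsmul]
      exact Nat.le_mul_of_pos_right _ (count_pos.2 hP)
    obtain ⟨z, hz⟩ := Multiset.le_iff_exists_add.1 hle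
    have hzH : z ∈ D.H := D.mem_of_add_mem (replicate_ord_mem P) (hz ▸ nsmul_mem hv _)
    have h2 : D.rep P' ^ D.ord P = D.rep P * D.θ z := by
      rw [← hθv, ← θ_nsmul (cls_of_mem hv), hz,
        D.θ_add (cls_of_mem (replicate_ord_mem P)) (cls_of_mem hzH), rep]
    have h3 := rep_eq_rep_of_pow_eq_mul h2
    obtain ⟨s, rfl⟩ := exists_cons_of_mem hPs
    rw [θ_expand, map_cons, prod_cons, h3] at h
    rw [map_cons, map_cons, h3, ih (mul_left_cancel h)]

/-! ### Weights -/

variable (D) in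
/-- The multiplicity of `y` in the image under `θ` of the (ideal represented by the) multiset `S`,
measured in the free monoid generated by the elements `rep P`. A prime `P` with `rep P = y`
contributes `1 / ord P`, since `rep P` is the image of `P ^ ord P`. -/
noncomputable def weight (y : B) (S : Multiset ι) : ℚ := by
  classical exact (S.map fun P => if D.rep P = y then (D.ord P : ℚ)⁻¹ else 0).sum

@[simp] lemma weight_zero (y : B) : D.weight y 0 = 0 := by simp [weight]

lemma weight_cons_of_eq {y : B} {P : ι} (S : Multiset ι) (h : D.rep P = y) :
    D.weight y (P ::ₘ S) = (D.ord P : ℚ)⁻¹ + D.weight y S := by simp [weight, h]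

lemma weight_cons_of_ne {y : B} {P : ι} (S : Multiset ι) (h : D.rep P ≠ y) :
    D.weight y (P ::ₘ S) = D.weight y S := by simp [weight, h]

lemma weight_eq_card_mul {y : B} {P : ι} {S : Multiset ι} (h : D.rep P = y)
    (hS : ∀ Q ∈ S, D.rep Q = y → Q = P) [DecidableEq ι] :
    D.weight y S = count P S * (D.ord P : ℚ)⁻¹ := by
  induction S using Multiset.induction with
  | empty => simp
  | cons Q S ih =>
    have ih := ih fun R hR => hS R (mem_cons_of_mem hR)
    by_cases hQ : D.rep Q = y
    · obtain rfl := hS Q (mem_cons_self _ _) hQ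
      rw [weight_cons_of_eq _ hQ, ih, count_cons_self]
      push_cast
      ring
    · rw [weight_cons_of_ne _ hQ, ih, count_cons_of_ne]
      rintro rfl
      exact hQ h

variable (D) in
/-- For a common multiple `L` of the orders of the primes in `s`, the multiset whose expansion
is `L • s`. -/
noncomputable def contract (L : ℕ) (s : Multiset ι) : Multiset ι :=
  s.bind fun P => replicate (L / D.ord P) P

lemma expand_replicate (k : ℕ) (P : ι) :
    D.expand (replicate k P) = replicate (k * D.ord P) P := by
  induction k with
  | zero => simp [expand]
  | succ k ih =>
    rw [replicate_succ, expand, cons_bind, ← expand, ih, ← replicate_add, Nat.succ_mul, add_comm]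

lemma expand_contract {L : ℕ} {s : Multiset ι} (h : ∀ P ∈ s, D.ord P ∣ L) :
    D.expand (D.contract L s) = L • s := by
  induction s using Multiset.induction with
  | empty => simp [contract, expand]
  | cons P s ih =>
    have ih := ih fun Q hQ => h Q (mem_cons_of_mem hQ)
    have h1 : D.expand (replicate (L / D.ord P) P) = L • {P} := by
      rw [expand_replicate, Nat.div_mul_cancel (h P (mem_cons_self _ _)), nsmul_singleton]
    rw [contract, cons_bind, expand, add_bind, ← singleton_add, smul_add, ← ih, ← h1]
    rfl

lemma count_map_rep_contract {L : ℕ} {s : Multiset ι} (h : ∀ P ∈ s, D.ord P ∣ L) (y : B)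
    [DecidableEq B] : (count y ((D.contract L s).map D.rep) : ℚ) = L * D.weight y s := by
  induction s using Multiset.induction with
  | empty => simp [contract]
  | cons P s ih =>
    have ih := ih fun Q hQ => h Q (mem_cons_of_mem hQ)
    rw [contract, cons_bind, Multiset.map_add, count_add, Nat.cast_add, ← contract, ih,
      map_replicate, count_replicate]
    split_ifs with hP
    · rw [weight_cons_of_eq _ hP, Nat.cast_div (h P (mem_cons_self _ _))
        (by exact_mod_cast (ord_pos P).ne')]
      ring
    · rw [weight_cons_of_ne _ hP]
      simp

lemma exists_common_multiple (s : Multiset ι) : ∃ L : ℕ, 0 < L ∧ ∀ P ∈ s, D.ord P ∣ L := by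
  refine ⟨(s.map D.ord).prod, ?_, fun P hP => dvd_prod (mem_map_of_mem _ hP)⟩
  apply Nat.pos_of_ne_zero
  apply prod_ne_zero
  intro h
  obtain ⟨P, -, hP⟩ := mem_map.1 h
  exact (ord_pos P).ne' hP

lemma θ_pow_eq_prod {L : ℕ} {a : Multiset ι} (ha : D.cls a = 1) (h : ∀ P ∈ a, D.ord P ∣ L) :
    D.θ a ^ L = ((D.contract L a).map D.rep).prod := by
  rw [← θ_nsmul ha, ← expand_contract h, θ_expand]

lemma weight_eq_of_θ_eq {a v : Multiset ι} (ha : D.cls a = 1) (hv : D.cls v = 1)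
    (h : D.θ a = D.θ v) (y : B) : D.weight y a = D.weight y v := by
  classical
  obtain ⟨L, hL, hd⟩ := exists_common_multiple (D := D) (a + v)
  have h1 : ∀ P ∈ a, D.ord P ∣ L := fun P hP => hd P (mem_add.2 (Or.inl hP))
  have h2 : ∀ P ∈ v, D.ord P ∣ L := fun P hP => hd P (mem_add.2 (Or.inr hP))
  have h3 : ((D.contract L a).map D.rep).prod = ((D.contract L v).map D.rep).prod := by
    rw [← θ_pow_eq_prod ha h1, ← θ_pow_eq_prod hv h2, h]
  have h4 := congrArg (fun s => (count y s : ℚ)) (map_rep_eq_of_prod_eq h3)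
  simp only [count_map_rep_contract h1, count_map_rep_contract h2] at h4
  exact mul_left_cancel₀ (by exact_mod_cast hL.ne') h4

lemma ord_eq_one_iff {P : ι} : D.ord P = 1 ↔ D.cl P = 1 := orderOf_eq_one_iff

/-- Root-closedness of the codomain of `θ` makes `θ` detect classes. If `Q'` is a prime in the class
inverse to that of `Q` and `U` is one with `P Q' U` principal, then `θ (Q Q')` divides `θ (P Q' U)`,
and a power of the quotient is a power of `rep U`. So the quotient itself is one, and `U` is
principal. -/
lemma cl_eq_of_rep_eq {P Q : ι} (h : D.rep P = D.rep Q) (ho : D.ord P = D.ord Q) :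
    D.cl P = D.cl Q := by
  obtain ⟨Q', hQ'⟩ := D.cl_surjective (D.cl Q)⁻¹
  obtain ⟨U, hU⟩ := D.cl_surjective (D.cl Q / D.cl P)
  set M := D.ord P * D.ord Q' * D.ord U with hM
  have hM0 : M ≠ 0 := by simp [hM, (ord_pos P).ne', (ord_pos Q').ne', (ord_pos U).ne']
  have ha : D.cls (P ::ₘ Q' ::ₘ {U}) = 1 := by simp [hQ', hU, div_eq_mul_inv]
  have hb : D.cls (Q ::ₘ {Q'}) = 1 := by simp [hQ']
  have e1 : ∀ {X : ι} (k), D.cls (replicate (k * D.ord X) X) = 1 := fun {X} k =>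
    cls_of_mem (replicate_mem_iff.2 (dvd_mul_left _ _))
  have h1 : M • (P ::ₘ Q' ::ₘ {U}) = replicate ((D.ord Q' * D.ord U) * D.ord P) P +
      (replicate ((D.ord P * D.ord U) * D.ord Q') Q' +
        replicate ((D.ord P * D.ord Q') * D.ord U) U) := by
    rw [← singleton_add, ← singleton_add, smul_add, smul_add, nsmul_singleton, nsmul_singleton,
      nsmul_singleton]
    congr 3 <;> (rw [hM]; ring)
  have h2 : M • (Q ::ₘ {Q'}) = replicate ((D.ord Q' * D.ord U) * D.ord Q) Q +
      replicate ((D.ord P * D.ord U) * D.ord Q') Q' := by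
    rw [← singleton_add, smul_add, nsmul_singleton, nsmul_singleton]
    congr 2 <;> rw [hM] <;> simp only [ho] <;> ring
  have h3 : D.θ (P ::ₘ Q' ::ₘ {U}) ^ M =
      D.θ (Q ::ₘ {Q'}) ^ M * D.rep U ^ (D.ord P * D.ord Q') := by
    rw [← θ_nsmul ha, ← θ_nsmul hb, h1, h2, D.θ_add (e1 _) (by
      change D.cls _ = 1
      rw [cls_add, e1, e1, one_mul]), D.θ_add (e1 _) (e1 _), D.θ_add (e1 _) (e1 _)]
    simp only [θ_replicate_mul]
    rw [h, mul_assoc]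
  obtain ⟨β, hβ⟩ := D.exists_eq_mul_of_pow hM0 h3
  rw [hβ, mul_pow] at h3
  have h4 := mul_left_cancel h3
  obtain ⟨M', hM'⟩ := Nat.exists_eq_succ_of_ne_zero hM0
  obtain ⟨i, -, -, hi, -⟩ := rep_pow_eq_mul (P := U) (b := β) (c := β ^ M') (by
    rw [← h4, hM', pow_succ'])
  rw [hi, ← pow_mul] at h4
  have h5 := rep_pow_injective h4
  have h6 : i * D.ord U = 1 := by
    have : 0 < D.ord P * D.ord Q' := Nat.mul_pos (ord_pos _) (ord_pos _)
    apply Nat.eq_of_mul_eq_mul_left this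
    rw [mul_one]
    conv_rhs => rw [← h5, hM]
    ring
  have h7 : D.cl U = 1 := ord_eq_one_iff.1 (Nat.eq_one_of_mul_eq_one_left h6)
  rw [hU] at h7
  exact (div_eq_one.1 h7).symm

/-- If all primes dividing `a` have the same image under `rep`, so that `θ a` is a root of a power
of that image, then `θ a` is a power of it. -/
lemma exists_weight_eq_natCast {a : Multiset ι} (ha : D.cls a = 1) {y : B}
    (hy : ∀ P ∈ a, D.rep P = y) : ∃ r : ℕ, D.weight y a = r := by
  classical
  rcases eq_or_ne a 0 with rfl | h0
  · exact ⟨0, by simp⟩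
  obtain ⟨P, hP⟩ := exists_mem_of_ne_zero h0
  obtain rfl := hy P hP
  obtain ⟨L, hL, hd⟩ := exists_common_multiple (D := D) a
  have h1 : (D.contract L a).map D.rep = replicate (card (D.contract L a)) (D.rep P) := by
    rw [eq_replicate]
    refine ⟨by simp, ?_⟩
    intro b hb
    obtain ⟨Q, hQ, rfl⟩ := mem_map.1 hb
    obtain ⟨R, hR, hQ⟩ := mem_bind.1 hQ
    rw [(mem_replicate.1 hQ).2]
    exact hy R hR
  have h2 := θ_pow_eq_prod ha hd
  obtain ⟨L, rfl⟩ := Nat.exists_eq_succ_of_ne_zero hL.ne'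
  rw [h1, prod_replicate, pow_succ'] at h2
  obtain ⟨r, -, -, hr, -⟩ := rep_pow_eq_mul h2.symm
  refine ⟨r, ?_⟩
  rw [← θ_replicate_mul] at hr
  rw [weight_eq_of_θ_eq ha (cls_of_mem (replicate_mem_iff.2 (dvd_mul_left _ _))) hr,
    weight_eq_card_mul rfl (fun Q hQ _ => (mem_replicate.1 hQ).2), count_replicate_self]
  have : (D.ord P : ℚ) ≠ 0 := by exact_mod_cast (ord_pos P).ne'
  push_cast
  field_simp

/-- If distinct primes in `a` have distinct images under `rep`, then `θ a` determines `a` among the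
products of these primes, and so `a` itself is the member of `H` with this image. -/
lemma mem_of_injOn {a : Multiset ι} (ha : D.cls a = 1)
    (h : ∀ P ∈ a, ∀ Q ∈ a, D.rep P = D.rep Q → P = Q) : a ∈ D.H := by
  classical
  obtain ⟨v, hv, hθ, -, hQ⟩ := exists_mem_θ_eq_card_le ha
  suffices a = v by rwa [this]
  ext P
  by_cases hP : P ∈ a
  · have h1 := weight_eq_of_θ_eq ha (cls_of_mem hv) hθ.symm (D.rep P)
    rw [weight_eq_card_mul rfl (fun Q hQ e => h Q hQ P hP e),
      weight_eq_card_mul rfl (fun Q hQv e => h Q (hQ Q hQv) P hP e)] at h1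
    have h2 : (D.ord P : ℚ)⁻¹ ≠ 0 := inv_ne_zero (by exact_mod_cast (ord_pos P).ne')
    exact_mod_cast mul_right_cancel₀ h2 h1
  · rw [count_eq_zero_of_notMem hP, count_eq_zero_of_notMem fun h => hP (hQ P h)]

/-! ### Pairs of primes of opposite class -/

lemma rep_ne_of_cl_eq_inv {P Q : ι} (h : D.cl Q = (D.cl P)⁻¹) (hP : 3 ≤ D.ord P) :
    D.rep P ≠ D.rep Q := by
  intro hr
  have h1 := cl_eq_of_rep_eq hr (by rw [ord, ord, h, orderOf_inv])
  have h2 : D.cl P ^ 2 = 1 := by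
    rw [pow_two]
    nth_rewrite 2 [h1]
    rw [h, mul_inv_cancel]
  have := Nat.le_of_dvd two_pos (orderOf_dvd_of_pow_eq_one h2)
  rw [ord] at hP
  omega

lemma pair_mem_of_three_le_ord {P Q : ι} (h : D.cl Q = (D.cl P)⁻¹) (hP : 3 ≤ D.ord P) :
    P ::ₘ {Q} ∈ D.H := by
  have hne := rep_ne_of_cl_eq_inv h hP
  apply mem_of_injOn (by simp [h])
  intro X hX Y hY hXY
  simp only [mem_cons, mem_singleton] at hX hY
  rcases hX with rfl | rfl <;> rcases hY with rfl | rfl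
  · rfl
  · exact absurd hXY hne
  · exact absurd hXY.symm hne
  · rfl

lemma pair_mem {P Q : ι} (h : D.cl P * D.cl Q = 1) (hPQ : D.cl P = D.cl Q → P = Q) :
    P ::ₘ {Q} ∈ D.H := by
  rcases le_or_gt 3 (D.ord P) with hP | hP
  · exact pair_mem_of_three_le_ord (eq_inv_of_mul_eq_one_right h) hP
  · have hd : D.ord P ∣ 2 := by
      have := ord_pos (D := D) P
      interval_cases D.ord P <;> norm_num
    have h2 : D.cl P * D.cl P = 1 := by
      rw [← pow_two]
      exact orderOf_dvd_iff_pow_eq_one.1 hd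
    obtain rfl := hPQ (mul_left_cancel (h2.trans h.symm))
    exact replicate_mem_iff.2 hd

lemma singleton_mem {P : ι} (h : D.cl P = 1) : {P} ∈ D.H :=
  replicate_mem_iff (k := 1).2 (by rw [ord_eq_one_iff.2 h])

/-! ### Triples of primes of trivial class -/

lemma weight_add (y : B) (S T : Multiset ι) :
    D.weight y (S + T) = D.weight y S + D.weight y T := by simp [weight]

lemma weight_replicate_of_eq {y : B} {P : ι} (n : ℕ) (h : D.rep P = y) :
    D.weight y (replicate n P) = n * (D.ord P : ℚ)⁻¹ := by simp [weight, h]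

lemma weight_replicate_of_ne {y : B} {P : ι} (n : ℕ) (h : D.rep P ≠ y) :
    D.weight y (replicate n P) = 0 := by simp [weight, h]

/-- A member of `H` with the same image as `P Q T` which is divisible by `P` must be `P Q T`, by
comparison of weights. -/
lemma triple_mem_of_rep_eq {P Q T : ι} (h : D.cls (P ::ₘ Q ::ₘ {T}) = 1)
    (hPQ : D.rep P = D.rep Q) (hlt : D.ord P < D.ord Q) (hT : D.rep T ≠ D.rep P) :
    P ::ₘ Q ::ₘ {T} ∈ D.H := by
  classical
  obtain ⟨v, hv, hθ, hPv, hsup⟩ := exists_mem_θ_eq h (mem_cons_self P _)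
  have hQP : Q ≠ P := by rintro rfl; exact lt_irrefl _ hlt
  have hTP : T ≠ P := by rintro rfl; exact hT rfl
  have hTQ : T ≠ Q := by rintro rfl; exact hT hPQ.symm
  have hveq : v = replicate (count P v) P + (replicate (count Q v) Q +
      replicate (count T v) T) := by
    ext X
    simp only [count_add, count_replicate]
    by_cases hX : X ∈ v
    · have := hsup X hX
      simp only [mem_cons, mem_singleton] at this
      rcases this with rfl | rfl | rfl
      · simp [hQP, hTP]
      · simp [hQP.symm, hTQ]
      · simp [hTP.symm, hTQ.symm]
    · rw [count_eq_zero_of_notMem hX]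
      split_ifs with h1 h2 h3 <;> simp_all
  have hi : 1 ≤ count P v := one_le_count_iff_mem.2 hPv
  have h1 := weight_eq_of_θ_eq (cls_of_mem hv) h hθ (D.rep P)
  have h2 := weight_eq_of_θ_eq (cls_of_mem hv) h hθ (D.rep T)
  set i := count P v
  set j := count Q v
  set k := count T v
  have hTPQ : D.rep Q ≠ D.rep T := fun e => hT (hPQ.trans e).symm
  have hs : P ::ₘ Q ::ₘ {T} = replicate 1 P + (replicate 1 Q + replicate 1 T) := rfl
  rw [hveq, hs] at h1 h2
  simp only [weight_add, weight_replicate_of_eq _ (rfl : D.rep P = _),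
    weight_replicate_of_eq _ hPQ.symm, weight_replicate_of_ne _ hT] at h1
  simp only [weight_add, weight_replicate_of_eq _ (rfl : D.rep T = _),
    weight_replicate_of_ne _ hTPQ, weight_replicate_of_ne _ hT.symm] at h2
  have hp : (0 : ℚ) < (D.ord P : ℚ)⁻¹ := inv_pos.2 (by exact_mod_cast ord_pos P)
  have hq : (0 : ℚ) < (D.ord Q : ℚ)⁻¹ := inv_pos.2 (by exact_mod_cast ord_pos Q)
  have ht : (0 : ℚ) < (D.ord T : ℚ)⁻¹ := inv_pos.2 (by exact_mod_cast ord_pos T)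
  have hqp : (D.ord Q : ℚ)⁻¹ < (D.ord P : ℚ)⁻¹ :=
    inv_strictAnti₀ (by exact_mod_cast ord_pos P) (by exact_mod_cast hlt)
  have hk : k = 1 := by
    have : (k : ℚ) * (D.ord T : ℚ)⁻¹ = (1 : ℕ) * (D.ord T : ℚ)⁻¹ := by linarith
    exact_mod_cast mul_right_cancel₀ ht.ne' this
  have hi1 : i = 1 := by
    by_contra hne
    have h3 : (2 : ℚ) ≤ i := by
      have : 2 ≤ i := by omega
      exact_mod_cast this
    have h4 : (0 : ℚ) ≤ j := Nat.cast_nonneg j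
    push_cast at h1
    nlinarith [mul_nonneg h4 hq.le, mul_le_mul_of_nonneg_right h3 hp.le]
  have hj : j = 1 := by
    rw [hi1] at h1
    have : (j : ℚ) * (D.ord Q : ℚ)⁻¹ = (1 : ℕ) * (D.ord Q : ℚ)⁻¹ := by linarith
    exact_mod_cast mul_right_cancel₀ hq.ne' this
  rw [hi1, hj, hk] at hveq
  rw [hs, ← hveq]
  exact hv

lemma exists_eq_cons_cons {a : Multiset ι} (h3 : card a = 3) {X Y : ι} (hX : X ∈ a) (hY : Y ∈ a)
    (hXY : X ≠ Y) : ∃ Z, a = X ::ₘ Y ::ₘ {Z} := by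
  obtain ⟨b, rfl⟩ := exists_cons_of_mem hX
  obtain ⟨c, rfl⟩ := exists_cons_of_mem ((mem_cons.1 hY).resolve_left hXY.symm)
  rw [card_cons, card_cons] at h3
  obtain ⟨Z, rfl⟩ := card_eq_one.1 (by omega : card c = 1)
  exact ⟨Z, rfl⟩

lemma exists_eq_cons_pair {a : Multiset ι} (h3 : card a = 3) {X : ι} (hX : X ∈ a) :
    ∃ Y Z, a = X ::ₘ Y ::ₘ {Z} := by
  obtain ⟨b, rfl⟩ := exists_cons_of_mem hX
  rw [card_cons] at h3
  obtain ⟨Y, Z, rfl⟩ := card_eq_two.1 (by omega : card b = 2)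
  exact ⟨Y, Z, rfl⟩

/-- The generic case for triples of trivial class: the three primes do not all have the same image
under `rep`. -/
lemma triple_mem_of_rep_ne {a : Multiset ι} (h3 : card a = 3) (h : D.cls a = 1)
    (hcl : ∀ X ∈ a, ∀ Y ∈ a, D.cl X = D.cl Y → X = Y)
    (hne : ∀ X ∈ a, ∃ Y ∈ a, D.rep Y ≠ D.rep X) : a ∈ D.H := by
  by_cases hinj : ∀ X ∈ a, ∀ Y ∈ a, D.rep X = D.rep Y → X = Y
  · exact mem_of_injOn h hinj
  push Not at hinj
  obtain ⟨X, hX, Y, hY, hrep, hXY⟩ := hinj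
  wlog hlt : D.ord X < D.ord Y generalizing X Y
  · refine this Y hY X hX hrep.symm hXY.symm (lt_of_le_of_ne (not_lt.1 hlt) ?_)
    exact fun e => hXY (hcl X hX Y hY (cl_eq_of_rep_eq hrep e.symm))
  obtain ⟨Z, rfl⟩ := exists_eq_cons_cons h3 hX hY hXY
  refine triple_mem_of_rep_eq h hrep hlt ?_
  obtain ⟨W, hW, hWX⟩ := hne X hX
  simp only [mem_cons, mem_singleton] at hW
  rcases hW with rfl | rfl | rfl
  · exact absurd rfl hWX
  · exact absurd hrep.symm hWX
  · exact hWX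

/-- When all three primes have the same image under `rep`, the primes in the inverse classes do not,
so the triple of these lies in `H`; the original triple is complementary to it. -/
lemma triple_mem_of_ord_eq_two {W X Y : ι} (h : D.cls (W ::ₘ X ::ₘ {Y}) = 1)
    (hW : D.ord W = 2) (hX : 3 ≤ D.ord X) (hY : 3 ≤ D.ord Y) (hWX : D.rep W = D.rep X) :
    W ::ₘ X ::ₘ {Y} ∈ D.H := by
  let σ := Function.surjInv D.cl_surjective
  have hσ : ∀ c, D.cl (σ c) = c := Function.surjInv_eq D.cl_surjective
  set X' := σ (D.cl X)⁻¹ with hX'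
  set Y' := σ (D.cl Y)⁻¹ with hY'
  have hoX : D.ord X' = D.ord X := by rw [ord, ord, hσ, orderOf_inv]
  have hoY : D.ord Y' = D.ord Y := by rw [ord, ord, hσ, orderOf_inv]
  have hWW : replicate 2 W ∈ D.H := replicate_mem_iff.2 (by rw [hW])
  have hcW : D.cl W * D.cl W = 1 := by
    rw [← pow_two, ← cls_replicate, cls_of_mem hWW]
  have hXX : X ::ₘ {X'} ∈ D.H := pair_mem_of_three_le_ord (hσ _) hX
  have hYY : Y ::ₘ {Y'} ∈ D.H := pair_mem_of_three_le_ord (hσ _) hY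
  have hr : D.rep X ≠ D.rep X' := rep_ne_of_cl_eq_inv (hσ _) hX
  have hWX' : D.cl W ≠ D.cl X' := by
    intro e
    rw [ord, e, ← ord] at hW
    omega
  have hWY' : D.cl W ≠ D.cl Y' := by
    intro e
    rw [ord, e, ← ord] at hW
    omega
  have hXY' : D.cl X' = D.cl Y' → X' = Y' := by
    intro e
    rw [hσ, hσ] at e
    rw [hX', hY', e]
  have hb : W ::ₘ X' ::ₘ {Y'} ∈ D.H := by
    apply triple_mem_of_rep_ne (by simp)
    · have h1 : D.cl W = (D.cl W)⁻¹ := eq_inv_of_mul_eq_one_left hcW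
      simp only [cls_cons, cls_singleton] at h ⊢
      rw [hσ, hσ, h1, ← mul_inv, ← mul_inv, h, inv_one]
    · intro A hA B hB hAB
      simp only [mem_cons, mem_singleton] at hA hB
      rcases hA with rfl | rfl | rfl <;> rcases hB with rfl | rfl | rfl
      · rfl
      · exact absurd hAB hWX'
      · exact absurd hAB hWY'
      · exact absurd hAB.symm hWX'
      · rfl
      · exact hXY' hAB
      · exact absurd hAB.symm hWY'
      · exact (hXY' hAB.symm).symm
      · rfl
    · intro A hA
      by_cases hAW : D.rep A = D.rep W
      · exact ⟨X', by simp, by rw [hAW, hWX]; exact hr.symm⟩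
      · exact ⟨W, by simp, Ne.symm hAW⟩
  apply D.mem_of_add_mem hb
  have : (W ::ₘ X' ::ₘ {Y'}) + (W ::ₘ X ::ₘ {Y}) =
      replicate 2 W + ((X ::ₘ {X'}) + (Y ::ₘ {Y'})) := by
    simp only [← singleton_add, replicate_succ, replicate_zero]
    abel
  rw [this]
  exact D.H.add_mem hWW (D.H.add_mem hXX hYY)

/-- Triples of trivial class in which primes of the same class are equal lie in `H`. If all three
primes have the same image under `rep`, the reciprocals of their orders add up to an integer. -/
lemma triple_mem_of_inj {a : Multiset ι} (h3 : card a = 3) (h : D.cls a = 1)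
    (hcl : ∀ X ∈ a, ∀ Y ∈ a, D.cl X = D.cl Y → X = Y) : a ∈ D.H := by
  by_cases hone : ∃ W ∈ a, D.cl W = 1
  · obtain ⟨W, hW, hW1⟩ := hone
    obtain ⟨X, Y, rfl⟩ := exists_eq_cons_pair h3 hW
    rw [← singleton_add]
    refine D.H.add_mem (singleton_mem hW1) (pair_mem ?_ (hcl X (by simp) Y (by simp)))
    simpa [hW1] using h
  push Not at hone
  by_cases hne : ∀ X ∈ a, ∃ Y ∈ a, D.rep Y ≠ D.rep X
  · exact triple_mem_of_rep_ne h3 h hcl hne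
  push Not at hne
  obtain ⟨Z, hZ, hrep⟩ := hne
  have hrep' : ∀ X ∈ a, ∀ Y ∈ a, D.rep X = D.rep Y := fun X hX Y hY =>
    (hrep X hX).trans (hrep Y hY).symm
  have hle : ∀ X ∈ a, 2 ≤ D.ord X := by
    intro X hX
    have h1 := ord_pos (D := D) X
    have h2 : D.ord X ≠ 1 := fun e => hone X hX (ord_eq_one_iff.1 e)
    omega
  have heq : ∀ X ∈ a, ∀ Y ∈ a, D.ord X = D.ord Y → X = Y := fun X hX Y hY e =>
    hcl X hX Y hY (cl_eq_of_rep_eq (hrep' X hX Y hY) e)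
  by_cases htwo : ∃ W ∈ a, D.ord W = 2
  · obtain ⟨W, hW, hW2⟩ := htwo
    obtain ⟨X, Y, rfl⟩ := exists_eq_cons_pair h3 hW
    have hWW : D.cl W * D.cl W = 1 := by
      rw [← pow_two, ← hW2]; exact pow_orderOf_eq_one _
    simp only [cls_cons, cls_singleton] at h
    have hX : D.ord X ≠ 2 := by
      intro e
      obtain rfl := heq X (by simp) W (by simp) (e.trans hW2.symm)
      rw [← mul_assoc, hWW, one_mul] at h
      exact hone Y (by simp) h
    have hY : D.ord Y ≠ 2 := by
      intro e
      obtain rfl := heq Y (by simp) W (by simp) (e.trans hW2.symm)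
      rw [mul_left_comm, hWW, mul_one] at h
      exact hone X (by simp) h
    refine triple_mem_of_ord_eq_two (by simpa using h) hW2 ?_ ?_
      (hrep' W (by simp) X (by simp))
    · have := hle X (by simp); omega
    · have := hle Y (by simp); omega
  push Not at htwo
  -- All orders are at least `3`, and their reciprocals add up to an integer, so all are `3`.
  obtain ⟨X, Y, rfl⟩ := exists_eq_cons_pair h3 hZ
  have hle3 : ∀ A ∈ (Z ::ₘ X ::ₘ {Y}), (D.ord A : ℚ)⁻¹ ≤ 1 / 3 ∧ 0 < (D.ord A : ℚ)⁻¹ := by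
    intro A hA
    have h1 := hle A hA
    have h2 := htwo A hA
    have h4 : (3 : ℚ) ≤ D.ord A := by exact_mod_cast (by omega : 3 ≤ D.ord A)
    refine ⟨?_, inv_pos.2 (by linarith)⟩
    rw [one_div]
    exact inv_anti₀ (by norm_num) h4
  obtain ⟨r, hr⟩ := exists_weight_eq_natCast h (y := D.rep Z) hrep
  have hs : Z ::ₘ X ::ₘ {Y} = replicate 1 Z + (replicate 1 X + replicate 1 Y) := rfl
  rw [hs, weight_add, weight_add, weight_replicate_of_eq _ rfl,
    weight_replicate_of_eq _ (hrep X (by simp)), weight_replicate_of_eq _ (hrep Y (by simp))] at hr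
  have hZ3 := hle3 Z (by simp)
  have hX3 := hle3 X (by simp)
  have hY3 := hle3 Y (by simp)
  push_cast at hr
  have hr1 : (1 : ℚ) ≤ r := by
    have : (0 : ℚ) < r := by rw [← hr]; linarith [hZ3.2, hX3.2, hY3.2]
    exact_mod_cast this
  have key : ∀ A, (D.ord A : ℚ)⁻¹ = 1 / 3 → D.ord A = 3 := by
    intro A hA
    rw [one_div, inv_inj] at hA
    exact_mod_cast hA
  have eZ := key Z (by linarith [hZ3.1, hX3.1, hY3.1])
  have eX := key X (by linarith [hZ3.1, hX3.1, hY3.1])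
  have eY := key Y (by linarith [hZ3.1, hX3.1, hY3.1])
  obtain rfl := heq Z (by simp) X (by simp) (eZ.trans eX.symm)
  obtain rfl := heq Z (by simp) Y (by simp) (eZ.trans eY.symm)
  exact replicate_mem_iff (k := 3).2 (by rw [eZ])

/-! ### Products of trivial class -/

/-- If the class group does not have two elements, primes in the same class are interchangeable. For
classes of order two this needs a third class. -/
lemma cons_mem_of_cl_eq (hC : Nat.card C ≠ 2) {P Q : ι} (h : D.cl P = D.cl Q) {S : Multiset ι}
    (hS : P ::ₘ S ∈ D.H) : Q ::ₘ S ∈ D.H := by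
  suffices ∃ X, P ::ₘ X ∈ D.H ∧ Q ::ₘ X ∈ D.H by
    obtain ⟨X, hP, hQ⟩ := this
    apply D.mem_of_add_mem hP
    have : P ::ₘ X + Q ::ₘ S = (Q ::ₘ X) + (P ::ₘ S) := by
      simp only [← singleton_add]
      abel
    rw [this]
    exact D.H.add_mem hQ hS
  have hPQ : D.ord P = D.ord Q := by rw [ord, ord, h]
  rcases le_or_gt 3 (D.ord P) with h3 | h3
  · obtain ⟨P', hP'⟩ := D.cl_surjective (D.cl P)⁻¹
    exact ⟨{P'}, pair_mem_of_three_le_ord hP' h3,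
      pair_mem_of_three_le_ord (by rw [hP', h]) (hPQ ▸ h3)⟩
  by_cases h1 : D.cl P = 1
  · exact ⟨0, singleton_mem h1, singleton_mem (h ▸ h1)⟩
  obtain ⟨d, hd1, hdP⟩ : ∃ d, d ≠ 1 ∧ d ≠ D.cl P := by
    by_contra! hd
    apply hC
    rw [Nat.card_eq_two_iff]
    refine ⟨1, D.cl P, Ne.symm h1, ?_⟩
    ext d
    by_cases hd1 : d = 1
    · simp [hd1]
    · simp [hd d hd1]
  have h2 : D.ord P = 2 := by
    have h4 := ord_pos (D := D) P
    have h5 : D.ord P ≠ 1 := fun e => h1 (ord_eq_one_iff.1 e)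
    omega
  have hPP : D.cl P * D.cl P = 1 := by rw [← pow_two, ← h2]; exact pow_orderOf_eq_one _
  let σ := Function.surjInv D.cl_surjective
  have hσ : ∀ c, D.cl (σ c) = c := Function.surjInv_eq D.cl_surjective
  have key : ∀ A, D.cl A = D.cl P → A ::ₘ σ d ::ₘ {σ (D.cl P * d)⁻¹} ∈ D.H := by
    intro A hA
    have hn : D.cl P ≠ (D.cl P * d)⁻¹ := by
      intro e
      rw [eq_inv_iff_mul_eq_one, ← mul_assoc, hPP, one_mul] at e
      exact hd1 e
    apply triple_mem_of_inj (by simp)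
    · simp [hσ, hA]
    · intro X hX Y hY hXY
      simp only [mem_cons, mem_singleton] at hX hY
      rcases hX with rfl | rfl | rfl <;> rcases hY with rfl | rfl | rfl <;>
        simp only [hσ, hA] at hXY
      · rfl
      · exact absurd hXY.symm hdP
      · exact absurd hXY hn
      · exact absurd hXY hdP
      · rfl
      · rw [← hXY]
      · exact absurd hXY.symm hn
      · rw [hXY]
      · rfl
  exact ⟨_, key P rfl, key Q h.symm⟩

lemma pair_mem_of_cls (hC : Nat.card C ≠ 2) {P Q : ι} (h : D.cl P * D.cl Q = 1) :
    P ::ₘ {Q} ∈ D.H := by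
  by_cases hPQ : D.cl P = D.cl Q
  · exact cons_mem_of_cl_eq hC hPQ.symm (pair_mem (by rw [← h, hPQ]) fun _ => rfl)
  · exact pair_mem h fun e => absurd e hPQ

lemma triple_mem_of_cls (hC : Nat.card C ≠ 2) {P Q T : ι} (h : D.cl P * (D.cl Q * D.cl T) = 1) :
    P ::ₘ Q ::ₘ {T} ∈ D.H := by
  let σ := Function.surjInv D.cl_surjective
  have hσ : ∀ c, D.cl (σ c) = c := Function.surjInv_eq D.cl_surjective
  have key : σ (D.cl P) ::ₘ σ (D.cl Q) ::ₘ {σ (D.cl T)} ∈ D.H := by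
    apply triple_mem_of_inj (by simp) (by simpa [hσ] using h)
    have : ∀ X ∈ σ (D.cl P) ::ₘ σ (D.cl Q) ::ₘ {σ (D.cl T)}, X = σ (D.cl X) := by
      intro X hX
      simp only [mem_cons, mem_singleton] at hX
      rcases hX with rfl | rfl | rfl <;> rw [hσ]
    intro X hX Y hY e
    rw [this X hX, this Y hY, e]
  have k1 := cons_mem_of_cl_eq hC (hσ _) key
  rw [cons_swap] at k1
  have k2 := cons_mem_of_cl_eq hC (hσ _) k1
  have e : Q ::ₘ P ::ₘ {σ (D.cl T)} = σ (D.cl T) ::ₘ P ::ₘ {Q} := by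
    simp only [← singleton_add]
    abel
  rw [e] at k2
  have k3 := cons_mem_of_cl_eq hC (hσ _) k2
  have e' : T ::ₘ P ::ₘ {Q} = P ::ₘ Q ::ₘ {T} := by
    simp only [← singleton_add]
    abel
  rwa [e'] at k3

/-- Membership in `H` of the triples of trivial class says that sending a class to the common
`H`-class of its primes is additive, and this propagates to all multisets. -/
theorem mem_of_cls_eq_one (hC : Nat.card C ≠ 2) {S : Multiset ι} (h : D.cls S = 1) : S ∈ D.H := by
  have key : ∀ S : Multiset ι, ∀ P, D.cl P * D.cls S = 1 → P ::ₘ S ∈ D.H := by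
    intro S
    induction S using Multiset.induction with
    | empty =>
      intro P hP
      exact singleton_mem (by simpa using hP)
    | cons Q S ih =>
      intro P hP
      rw [cls_cons] at hP
      obtain ⟨W, hW⟩ := D.cl_surjective (D.cls S)⁻¹
      obtain ⟨W', hW'⟩ := D.cl_surjective (D.cls S)
      have h1 := ih W (by rw [hW, inv_mul_cancel])
      have h2 : W ::ₘ {W'} ∈ D.H := pair_mem_of_cls hC (by rw [hW, hW', inv_mul_cancel])
      have h3 : P ::ₘ Q ::ₘ {W'} ∈ D.H := triple_mem_of_cls hC (by rw [hW', hP])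
      apply D.mem_of_add_mem h2
      have : (W ::ₘ {W'}) + (P ::ₘ Q ::ₘ S) = (W ::ₘ S) + (P ::ₘ Q ::ₘ {W'}) := by
        simp only [← singleton_add]
        abel
      rw [this]
      exact D.H.add_mem h1 h3
  obtain ⟨P, hP⟩ := D.cl_surjective 1
  have h1 := key S P (by rw [hP, h, one_mul])
  rw [← singleton_add] at h1
  exact D.mem_of_add_mem (singleton_mem hP) h1

end TransferSystem

end Combinatorics

/-! ### Root closed monoids -/

section Monoid

variable {B : Type*} [CancelCommMonoid B]

/-- Completely integrally closed monoids are root closed. -/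
lemma exists_eq_mul_of_pow_eq (hB : completeIntegralClosure B = carrier B) {n : ℕ} (hn : n ≠ 0)
    {x y z : B} (h : x ^ n = y ^ n * z) : ∃ b, x = y * b := by
  let φ := Algebra.GrothendieckGroup.of (M := B)
  have hφ : ∀ b, φ b ∈ carrier B := fun b => ⟨b, rfl⟩
  have hg : (φ x / φ y) ^ n = φ z := by
    rw [div_pow, div_eq_iff_eq_mul, ← map_pow, ← map_pow, ← map_mul, h, mul_comm]
  have hmem : φ x / φ y ∈ completeIntegralClosure B := by
    refine ⟨φ (y ^ n), hφ _, fun k _ => ?_⟩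
    -- Write `k = n q + r`, so that the `k`-th power of the quotient is `z ^ q (x / y) ^ r`.
    have hr := Nat.mod_lt k (Nat.pos_of_ne_zero hn)
    have : φ (y ^ n) * (φ x / φ y) ^ k = φ (z ^ (k / n) * (y ^ (n - k % n) * x ^ (k % n))) := by
      conv_lhs => rw [← Nat.div_add_mod k n, pow_add, pow_mul, hg, div_pow,
        ← Nat.sub_add_cancel hr.le, pow_add y, map_mul]
      rw [Nat.sub_add_cancel hr.le]
      simp only [map_mul, map_pow]
      rw [mul_assoc, mul_left_comm (φ y ^ (k % n)), mul_div_cancel]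
      exact mul_left_comm _ _ _
    rw [this]
    exact hφ _
  rw [hB] at hmem
  obtain ⟨b, hb⟩ := hmem
  refine ⟨b, Algebra.GrothendieckGroup.of_injective ?_⟩
  rw [map_mul, hb]
  exact (mul_div_cancel _ _).symm

/-- The reduced monoid of a cancellative monoid is cancellative. -/
noncomputable instance : CancelCommMonoid (Associates B) where
  mul_left_cancel a b c h := by
    induction a using Quotient.inductionOn with | _ a
    induction b using Quotient.inductionOn with | _ b
    induction c using Quotient.inductionOn with | _ c
    obtain ⟨u, hu⟩ := Quotient.exact h
    have hu' : a * b * u = a * c := hu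
    rw [mul_assoc] at hu'
    exact Quotient.sound ⟨u, mul_left_cancel hu'⟩

lemma associates_exists_eq_mul_of_pow_eq (hB : completeIntegralClosure B = carrier B) {n : ℕ}
    (hn : n ≠ 0) {x y z : Associates B} (h : x ^ n = y ^ n * z) : ∃ b, x = y * b := by
  obtain ⟨x, rfl⟩ := Associates.mk_surjective x
  obtain ⟨y, rfl⟩ := Associates.mk_surjective y
  obtain ⟨z, rfl⟩ := Associates.mk_surjective z
  rw [← Associates.mk_pow, ← Associates.mk_pow, Associates.mk_mul_mk,
    Associates.mk_eq_mk_iff_associated] at h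
  obtain ⟨u, hu⟩ := h.symm
  rw [mul_assoc] at hu
  obtain ⟨b, rfl⟩ := exists_eq_mul_of_pow_eq hB hn hu.symm
  exact ⟨Associates.mk b, Associates.mk_mul_mk.symm⟩

end Monoid

section Conductor

/-! ### Conductors and regular elements -/

variable {R : Type u} [CommRing R] {O : Subring R}

lemma mem_of_mem_conductor {x : R} (h : x ∈ conductor O) : x ∈ O :=
  (le_conductor_iff O _).1 le_rfl h

lemma conductor_ne_top (h : O ≠ ⊤) : conductor O ≠ ⊤ := by
  intro e
  apply h
  rw [eq_top_iff]
  intro x _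
  exact mem_of_mem_conductor (e ▸ Submodule.mem_top)

lemma mem_regularElements_iff {a : R} :
    a ∈ regularElements O ↔ IsCoprime (Ideal.span {a}) (conductor O) := by
  change IsUnit (Ideal.Quotient.mk (conductor O) a) ↔ _
  rw [Ideal.isCoprime_iff_exists]
  constructor
  · intro h
    obtain ⟨b, hb⟩ := h.exists_right_inv
    obtain ⟨b, rfl⟩ := Ideal.Quotient.mk_surjective b
    rw [← map_mul, ← map_one (Ideal.Quotient.mk _), eq_comm,
      Ideal.Quotient.mk_eq_mk_iff_sub_mem] at hb
    exact ⟨a * b, Ideal.mem_span_singleton.2 (dvd_mul_right _ _), 1 - a * b, hb, by ring⟩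
  · rintro ⟨i, hi, j, hj, hij⟩
    obtain ⟨b, rfl⟩ := Ideal.mem_span_singleton.1 hi
    apply IsUnit.of_mul_eq_one (Ideal.Quotient.mk _ b)
    rw [← map_mul, ← map_one (Ideal.Quotient.mk _), Ideal.Quotient.mk_eq_mk_iff_sub_mem]
    rw [← hij, sub_add_cancel_left]
    exact neg_mem hj

lemma regularElements_of_mul_mem {a b : R} (h : a * b ∈ regularElements O) :
    a ∈ regularElements O ∧ b ∈ regularElements O := by
  change IsUnit _ at h
  rw [map_mul] at h
  exact ⟨isUnit_of_mul_isUnit_left h, isUnit_of_mul_isUnit_right h⟩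

lemma ne_zero_of_mem_regularElements (h : O ≠ ⊤) {a : R} (ha : a ∈ regularElements O) : a ≠ 0 := by
  rintro rfl
  change IsUnit _ at ha
  rw [map_zero, isUnit_zero_iff, eq_comm, ← map_one (Ideal.Quotient.mk _),
    Ideal.Quotient.eq_zero_iff_mem, ← Ideal.eq_top_iff_one] at ha
  exact conductor_ne_top h ha

lemma exists_pow_sub_one_mem [Finite (R ⧸ conductor O)] {a : R} (ha : a ∈ regularElements O) :
    ∃ n : ℕ, 0 < n ∧ a ^ n - 1 ∈ conductor O := by
  obtain ⟨u, hu⟩ := (ha : IsUnit (Ideal.Quotient.mk (conductor O) a))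
  obtain ⟨n, hn, h⟩ := (isOfFinOrder_of_finite u).exists_pow_eq_one
  refine ⟨n, hn, ?_⟩
  rw [← Ideal.Quotient.mk_eq_mk_iff_sub_mem, map_pow, map_one, ← hu, ← Units.val_pow_eq_pow_val, h,
    Units.val_one]

lemma exists_pow_mem [Finite (R ⧸ conductor O)] {a : R} (ha : a ∈ regularElements O) :
    ∃ n : ℕ, 0 < n ∧ a ^ n ∈ O := by
  obtain ⟨n, hn, h⟩ := exists_pow_sub_one_mem ha
  exact ⟨n, hn, by simpa using O.add_mem (mem_of_mem_conductor h) O.one_mem⟩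

/-- A regular element of `O` has an inverse in `O` modulo the conductor, so divisibility by it
in `R` implies divisibility in `O`. -/
lemma mem_of_mul_mem [Finite (R ⧸ conductor O)] {a r : R} (ha : a ∈ regularElements O)
    (haO : a ∈ O) (h : a * r ∈ O) : r ∈ O := by
  obtain ⟨n, hn, hf⟩ := exists_pow_sub_one_mem ha
  obtain ⟨n, rfl⟩ := Nat.exists_eq_succ_of_ne_zero hn.ne'
  have h1 : r = a ^ n * (a * r) - (a ^ (n + 1) - 1) * r := by ring
  rw [h1]
  exact O.sub_mem (O.mul_mem (O.pow_mem haO n) h) (hf r)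

lemma isUnit_mem_regularElements {a : R} (h : IsUnit a) : a ∈ regularElements O :=
  h.map (Ideal.Quotient.mk (conductor O))

variable [IsDomain R]

/-- Since the target of a transfer homomorphism from `O⁰` is root closed and powers of regular
elements lie in `O`, the homomorphism extends to the regular elements of `R`: for `x ≠ 0` in the
conductor, the value at `r` is the quotient of the values at `x r` and `x`. -/
lemma exists_extension [Finite (R ⧸ conductor O)] (hO : O ≠ ⊤) (hf : conductor O ≠ ⊥)
    {B : Type*} [CancelCommMonoid B] (hB : completeIntegralClosure B = carrier B) (θ : O⁰ →* B) :
    ∃ Θ : regularElements O →* B, ∀ (a : O⁰) (ha : ((a : O) : R) ∈ regularElements O),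
      Θ ⟨_, ha⟩ = θ a := by
  obtain ⟨x, hx, hx0⟩ := Submodule.exists_mem_ne_zero_of_ne_bot hf
  have nz : ∀ {y : O}, (y : R) ≠ 0 → y ∈ O⁰ := fun {y} hy =>
    mem_nonZeroDivisors_of_ne_zero fun e => hy (by rw [e]; rfl)
  let X : O⁰ := ⟨⟨x, mem_of_mem_conductor hx⟩, nz hx0⟩
  let Y : regularElements O → O⁰ := fun r => ⟨⟨x * r, hx r⟩,
    nz (mul_ne_zero hx0 (ne_zero_of_mem_regularElements hO r.2))⟩
  have key : ∀ r : regularElements O, ∃ b, θ (Y r) = θ X * b := by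
    intro r
    obtain ⟨n, hn, hr⟩ := exists_pow_mem r.2
    let Z : O⁰ := ⟨⟨(r : R) ^ n, hr⟩,
      nz (pow_ne_zero n (ne_zero_of_mem_regularElements hO r.2))⟩
    apply exists_eq_mul_of_pow_eq hB hn.ne' (z := θ Z)
    rw [← map_pow, ← map_pow, ← map_mul]
    congr 1
    apply Subtype.ext
    apply Subtype.ext
    exact mul_pow x (r : R) n
  choose Θ hΘ using key
  refine ⟨⟨⟨Θ, ?_⟩, ?_⟩, ?_⟩
  · apply mul_left_cancel (a := θ X)
    rw [← hΘ, mul_one]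
    congr 1
    exact Subtype.ext (Subtype.ext (mul_one x))
  · intro r s
    apply mul_left_cancel (a := θ X * θ X)
    change θ X * θ X * Θ (r * s) = θ X * θ X * (Θ r * Θ s)
    rw [mul_assoc, ← hΘ, mul_mul_mul_comm, ← hΘ, ← hΘ, ← map_mul, ← map_mul]
    congr 1
    apply Subtype.ext
    apply Subtype.ext
    change x * (x * (r * s)) = x * r * (x * s)
    ring
  · intro a ha
    apply mul_left_cancel (a := θ X)
    change θ X * Θ _ = _
    rw [← hΘ, ← map_mul]
    rfl

end Conductor

/-! ### The transfer system of an order -/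

section System

variable {R : Type u} [CommRing R] {O : Subring R}

variable (O) in
/-- The nonzero prime ideals of `R` coprime to the conductor of `O`. -/
abbrev CoprimePrime := {P : Ideal R // P ≠ ⊥ ∧ P.IsPrime ∧ IsCoprime P (conductor O)}

/-- The product of a multiset of primes. -/
def prodIdeal (S : Multiset (CoprimePrime O)) : Ideal R := (S.map Subtype.val).prod

@[simp] lemma prodIdeal_zero : prodIdeal (0 : Multiset (CoprimePrime O)) = 1 := rfl

lemma prodIdeal_add (S T : Multiset (CoprimePrime O)) :
    prodIdeal (S + T) = prodIdeal S * prodIdeal T := by simp [prodIdeal]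

lemma prodIdeal_cons (P : CoprimePrime O) (S : Multiset (CoprimePrime O)) :
    prodIdeal (P ::ₘ S) = P.1 * prodIdeal S := by simp [prodIdeal]

lemma prodIdeal_nsmul (n : ℕ) (S : Multiset (CoprimePrime O)) :
    prodIdeal (n • S) = prodIdeal S ^ n := by
  simp [prodIdeal, Multiset.map_nsmul, Multiset.prod_nsmul]

lemma isCoprime_prodIdeal (S : Multiset (CoprimePrime O)) :
    IsCoprime (prodIdeal S) (conductor O) := by
  induction S using Multiset.induction with
  | empty => exact isCoprime_one_left
  | cons P S ih => rw [prodIdeal_cons]; exact P.2.2.2.mul_left ih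

lemma mem_regularElements_of_prodIdeal_eq {S : Multiset (CoprimePrime O)} {a : R}
    (h : prodIdeal S = Ideal.span {a}) : a ∈ regularElements O :=
  mem_regularElements_iff.2 (h ▸ isCoprime_prodIdeal S)

variable [IsDedekindDomain R]

lemma prodIdeal_injective : Function.Injective (prodIdeal (O := O)) := by
  have key : ∀ S : Multiset (CoprimePrime O),
      UniqueFactorizationMonoid.normalizedFactors (prodIdeal S) = S.map Subtype.val := by
    intro S
    apply UniqueFactorizationMonoid.normalizedFactors_prod_of_prime
    intro P hP
    obtain ⟨P, -, rfl⟩ := Multiset.mem_map.1 hP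
    exact Ideal.prime_of_isPrime P.2.1 P.2.2.1
  intro S T h
  apply Multiset.map_injective Subtype.val_injective
  rw [← key, ← key, h]

lemma prodIdeal_ne_bot (S : Multiset (CoprimePrime O)) : prodIdeal S ≠ ⊥ := by
  induction S using Multiset.induction with
  | empty => exact one_ne_zero
  | cons P S ih => rw [prodIdeal_cons]; exact mul_ne_zero P.2.1 ih

lemma exists_prodIdeal_eq {I : Ideal R} (hI : I ≠ ⊥) (hc : IsCoprime I (conductor O)) :
    ∃ S : Multiset (CoprimePrime O), prodIdeal S = I := by
  have h : ∀ P ∈ UniqueFactorizationMonoid.normalizedFactors I,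
      P ≠ ⊥ ∧ P.IsPrime ∧ IsCoprime P (conductor O) := by
    intro P hP
    have h1 := UniqueFactorizationMonoid.prime_of_normalized_factor P hP
    exact ⟨h1.ne_zero, Ideal.isPrime_of_prime h1,
      hc.of_isCoprime_of_dvd_left (UniqueFactorizationMonoid.dvd_of_mem_normalizedFactors hP)⟩
  refine ⟨(UniqueFactorizationMonoid.normalizedFactors I).pmap (fun P hP => ⟨P, hP⟩) h, ?_⟩
  rw [prodIdeal, Multiset.map_pmap, Multiset.pmap_eq_map, Multiset.map_id',
    Ideal.prod_normalizedFactors_eq_self hI]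

lemma exists_prodIdeal_eq_span (hO : O ≠ ⊤) {a : R} (ha : a ∈ regularElements O) :
    ∃ S : Multiset (CoprimePrime O), prodIdeal S = Ideal.span {a} := by
  apply exists_prodIdeal_eq _ (mem_regularElements_iff.1 ha)
  rw [Ne, Ideal.span_singleton_eq_bot]
  exact ne_zero_of_mem_regularElements hO ha

/-- The class of a prime coprime to the conductor. -/
noncomputable def primeClass (P : CoprimePrime O) : ClassGroup R :=
  ClassGroup.mk0 ⟨P.1, mem_nonZeroDivisors_of_ne_zero P.2.1⟩

lemma prod_primeClass (S : Multiset (CoprimePrime O)) :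
    (S.map primeClass).prod =
      ClassGroup.mk0 ⟨prodIdeal S, mem_nonZeroDivisors_of_ne_zero (prodIdeal_ne_bot S)⟩ := by
  induction S using Multiset.induction with
  | empty =>
    rw [Multiset.map_zero, Multiset.prod_zero]
    exact (map_one _).symm
  | cons P S ih =>
    rw [Multiset.map_cons, Multiset.prod_cons, ih, primeClass, ← map_mul]
    congr 1
    exact Subtype.ext (prodIdeal_cons P S).symm

lemma prod_primeClass_eq_one_iff {S : Multiset (CoprimePrime O)} :
    (S.map primeClass).prod = 1 ↔
      ∃ a : regularElements O, prodIdeal S = Ideal.span {(a : R)} := by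
  rw [prod_primeClass, ClassGroup.mk0_eq_one_iff]
  constructor
  · rintro ⟨a, ha⟩
    exact ⟨⟨a, mem_regularElements_of_prodIdeal_eq ha⟩, ha⟩
  · rintro ⟨a, ha⟩
    exact ⟨a, ha⟩

lemma exists_generator_of_add [Finite (R ⧸ conductor O)] (hO : O ≠ ⊤)
    {S T : Multiset (CoprimePrime O)} {a c : R} (haO : a ∈ O) (hS : prodIdeal S = Ideal.span {a})
    (hcO : c ∈ O) (hST : prodIdeal (S + T) = Ideal.span {c}) :
    ∃ r ∈ O, prodIdeal T = Ideal.span {r} := by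
  have ha := mem_regularElements_of_prodIdeal_eq hS
  rw [prodIdeal_add, hS] at hST
  have hc : c ∈ Ideal.span {a} := by
    have : c ∈ Ideal.span {a} * prodIdeal T := by
      rw [hST]
      exact Ideal.mem_span_singleton_self c
    exact (Ideal.mul_le_inf this).1
  obtain ⟨r, hr⟩ := Ideal.mem_span_singleton.1 hc
  have hrO : a * r ∈ O := by
    rw [← hr]
    exact hcO
  refine ⟨r, mem_of_mul_mem ha haO hrO, ?_⟩
  rw [hr, ← Ideal.span_singleton_mul_span_singleton] at hST
  exact (Ideal.span_singleton_mul_right_inj (ne_zero_of_mem_regularElements hO ha)).1 hST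

variable {B : Type*} [CancelCommMonoid B] (Θ : regularElements O →* B)

open Classical in
/-- The value of an extended transfer homomorphism at a generator of a product of primes, up to
units; `1` if the product is not principal. -/
noncomputable def prodValue (S : Multiset (CoprimePrime O)) : Associates B :=
  if h : ∃ a : regularElements O, prodIdeal S = Ideal.span {(a : R)} then
    Associates.mk (Θ h.choose) else 1

lemma prodValue_eq {S : Multiset (CoprimePrime O)} {a : regularElements O}
    (h : prodIdeal S = Ideal.span {(a : R)}) : prodValue Θ S = Associates.mk (Θ a) := by
  have h' : ∃ a : regularElements O, prodIdeal S = Ideal.span {(a : R)} := ⟨a, h⟩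
  rw [prodValue, dif_pos h', Associates.mk_eq_mk_iff_associated]
  obtain ⟨u, hu⟩ := Ideal.span_singleton_eq_span_singleton.1 (h'.choose_spec.symm.trans h)
  let v : (regularElements O)ˣ :=
    ⟨⟨u, isUnit_mem_regularElements u.isUnit⟩,
      ⟨(u⁻¹ : Rˣ), isUnit_mem_regularElements u⁻¹.isUnit⟩,
      Subtype.ext u.mul_inv, Subtype.ext u.inv_mul⟩
  refine ⟨Units.map Θ v, ?_⟩
  rw [Units.coe_map, ← map_mul]
  congr 1
  exact Subtype.ext hu

/-- The combinatorial data attached to an order and to a transfer homomorphism `θ` from it to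
a completely integrally closed monoid, with extension `Θ` to the regular elements of `R`. -/
noncomputable def orderSystem [Finite (R ⧸ conductor O)] (hO : O ≠ ⊤)
    (hR : IsMulTorsion (ClassGroup R))
    (hprime : Function.Surjective (primeClass (O := O)))
    (hB : completeIntegralClosure B = carrier B) (θ : O⁰ →* B) (hθ : IsTransferHom θ)
    (hΘ : ∀ (a : O⁰) (ha : ((a : O) : R) ∈ regularElements O), Θ ⟨_, ha⟩ = θ a) :
    TransferSystem (CoprimePrime O) (ClassGroup R) (Associates B) where
  cl := primeClass
  cl_surjective := hprime
  torsion := hR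
  H :=
    { carrier := {S | ∃ a ∈ O, prodIdeal S = Ideal.span {a}}
      zero_mem' := ⟨1, O.one_mem, by simp⟩
      add_mem' := by
        rintro S T ⟨a, ha, hS⟩ ⟨b, hb, hT⟩
        exact ⟨a * b, O.mul_mem ha hb, by
          rw [prodIdeal_add, hS, hT, Ideal.span_singleton_mul_span_singleton]⟩ }
  class_eq_one := by
    rintro S ⟨a, -, h⟩
    exact prod_primeClass_eq_one_iff.2 ⟨⟨a, mem_regularElements_of_prodIdeal_eq h⟩, h⟩
  mem_of_add_mem := by
    rintro S T ⟨a, haO, hS⟩ ⟨c, hcO, hST⟩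
    exact exists_generator_of_add hO haO hS hcO hST
  exists_nsmul_mem := by
    intro S h
    obtain ⟨a, ha⟩ := prod_primeClass_eq_one_iff.1 h
    obtain ⟨n, hn, h⟩ := exists_pow_mem a.2
    exact ⟨n, hn, _, h, by rw [prodIdeal_nsmul, ha, Ideal.span_singleton_pow]⟩
  θ := prodValue Θ
  θ_add := by
    intro S T hS hT
    obtain ⟨a, ha⟩ := prod_primeClass_eq_one_iff.1 hS
    obtain ⟨b, hb⟩ := prod_primeClass_eq_one_iff.1 hT
    have hab : prodIdeal (S + T) = Ideal.span {((a * b : regularElements O) : R)} := by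
      rw [prodIdeal_add, ha, hb, Ideal.span_singleton_mul_span_singleton]
      rfl
    rw [prodValue_eq Θ ha, prodValue_eq Θ hb, prodValue_eq Θ hab, Associates.mk_mul_mk, map_mul]
  eq_zero_of_θ_eq_one := by
    rintro S ⟨a, haO, hS⟩ h
    have ha := mem_regularElements_of_prodIdeal_eq hS
    rw [prodValue_eq Θ (a := ⟨a, ha⟩) hS, Associates.mk_eq_one] at h
    let a' : O⁰ := ⟨⟨a, haO⟩, mem_nonZeroDivisors_of_ne_zero fun e =>
      ne_zero_of_mem_regularElements hO ha (congrArg Subtype.val e)⟩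
    rw [hΘ a' ha, hθ.isUnit_iff] at h
    have hu : IsUnit a := (h.map (O⁰).subtype).map O.subtype
    apply prodIdeal_injective
    rw [hS, prodIdeal_zero, Ideal.one_eq_top, Ideal.span_singleton_eq_top]
    exact hu
  exists_lift := by
    rintro S b c ⟨a, haO, hS⟩ h
    have ha := mem_regularElements_of_prodIdeal_eq hS
    obtain ⟨b, rfl⟩ := Associates.mk_surjective b
    obtain ⟨c, rfl⟩ := Associates.mk_surjective c
    let a' : O⁰ := ⟨⟨a, haO⟩, mem_nonZeroDivisors_of_ne_zero fun e =>
      ne_zero_of_mem_regularElements hO ha (congrArg Subtype.val e)⟩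
    rw [prodValue_eq Θ (a := ⟨a, ha⟩) hS, Associates.mk_mul_mk,
      Associates.mk_eq_mk_iff_associated, hΘ a' ha] at h
    obtain ⟨t, ht⟩ := h.symm
    rw [mul_assoc] at ht
    obtain ⟨x, y, hxy, hx, hy⟩ := hθ.exists_lift a' b (c * t) ht.symm
    have hxyR : ((x : O) : R) * ((y : O) : R) = a :=
      (congrArg (fun z : O⁰ => ((z : O) : R)) hxy).symm
    obtain ⟨hxr, hyr⟩ := regularElements_of_mul_mem (hxyR ▸ ha)
    obtain ⟨S₁, h₁⟩ := exists_prodIdeal_eq_span hO hxr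
    obtain ⟨S₂, h₂⟩ := exists_prodIdeal_eq_span hO hyr
    refine ⟨S₁, ⟨_, (x : O).2, h₁⟩, S₂, ⟨_, (y : O).2, h₂⟩, ?_, ?_, ?_⟩
    · apply prodIdeal_injective
      rw [hS, prodIdeal_add, h₁, h₂, Ideal.span_singleton_mul_span_singleton, hxyR]
    · rw [prodValue_eq Θ (a := ⟨_, hxr⟩) h₁, hΘ x hxr]
      exact Associates.mk_eq_mk_iff_associated.2 hx
    · rw [prodValue_eq Θ (a := ⟨_, hyr⟩) h₂, hΘ y hyr]
      exact Associates.mk_eq_mk_iff_associated.2 (hy.trans ⟨t⁻¹, by simp⟩)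
  exists_eq_mul_of_pow := fun hn h => associates_exists_eq_mul_of_pow_eq hB hn h
  eq_one_of_mul_eq_one := fun h => eq_one_of_mul_right h

/-- Every regular element `a` of `R` is associated to an element of `O`: the multiset of prime
factors of `a` has trivial class, hence lies in `H`. -/
theorem exists_associated_mem [Finite (R ⧸ conductor O)] (hO : O ≠ ⊤) (hf : conductor O ≠ ⊥)
    (hR : IsMulTorsion (ClassGroup R)) (hprime : Function.Surjective (primeClass (O := O)))
    (hTK : IsTransferKrull.{u, v} O⁰) (hcard : Nat.card (ClassGroup R) ≠ 2)
    {a : R} (ha : a ∈ regularElements O) : ∃ b ∈ O, Associated a b := by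
  obtain ⟨B, _, hB, θ, hθ⟩ := hTK
  obtain ⟨Θ, hΘ⟩ := exists_extension hO hf hB.completelyIntegrallyClosed θ
  obtain ⟨S, hS⟩ := exists_prodIdeal_eq_span hO ha
  obtain ⟨b, hb, h⟩ := TransferSystem.mem_of_cls_eq_one (S := S)
    (D := orderSystem Θ hO hR hprime hB.completelyIntegrallyClosed θ hθ hΘ) hcard
    (prod_primeClass_eq_one_iff.2 ⟨⟨a, ha⟩, hS⟩)
  exact ⟨b, hb, Ideal.span_singleton_eq_span_singleton.1 (hS.symm.trans h)⟩

end System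

/-! ### Ideals coprime to a given ideal in their class -/

section Representatives

variable {A : Type*} [CommRing A] [IsDomain A]

open FractionalIdeal in
/-- An invertible fractional ideal `I'` with inverse `I` has an integral multiple `y I'`, `y ∈ I`,
coprime to a given ideal contained in only finitely many maximal ideals: by the Chinese remainder
theorem `y` can be chosen outside `M I` for each of these maximal ideals `M`. -/
lemma exists_coprime_multiple {K : Type*} [Field K] [Algebra A K] [IsFractionRing A K]
    {𝔞 : Ideal A} (hf : {M : Ideal A | M.IsMaximal ∧ 𝔞 ≤ M}.Finite)
    {I I' : FractionalIdeal A⁰ K} (hinv : I * I' = 1) :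
    ∃ (y : K) (J : Ideal A), (J : FractionalIdeal A⁰ K) = spanSingleton A⁰ y * I' ∧ J ⊔ 𝔞 = ⊤ := by
  classical
  set s := hf.toFinset with hs
  have hmax : ∀ M ∈ s, M.IsMaximal := fun M hM => (hf.mem_toFinset.1 hM).1
  have hint : ∀ {a b : K}, a ∈ I → b ∈ I' → ∃ c : A, algebraMap A K c = a * b := by
    intro a b ha hb
    have : a * b ∈ (1 : FractionalIdeal A⁰ K) := hinv ▸ mul_mem_mul ha hb
    exact (mem_one_iff _).1 this
  have h1 : ∀ M ∈ s, ∃ a ∈ I, ∃ b ∈ I', a * b ∉ (M : FractionalIdeal A⁰ K) := by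
    intro M hM
    by_contra! h
    have h2 : I * I' ≤ (M : FractionalIdeal A⁰ K) := FractionalIdeal.mul_le.2 h
    rw [hinv, ← coeIdeal_top, coeIdeal_le_coeIdeal] at h2
    exact (hmax M hM).ne_top (top_le_iff.1 h2)
  have h2 : ∀ M ∈ s, ∃ e : A, e ∉ M ∧ ∀ M' ∈ s, M' ≠ M → e ∈ M' := by
    intro M hM
    have hlt : ¬ ⨅ M' ∈ s.erase M, M' ≤ M := by
      have hc : M ⊔ ⨅ M' ∈ s.erase M, M' = ⊤ := Ideal.sup_iInf_eq_top fun M' hM' =>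
        Ideal.IsMaximal.coprime_of_ne (hmax M hM) (hmax M' (Finset.mem_of_mem_erase hM'))
          (Finset.ne_of_mem_erase hM').symm
      intro hle
      rw [sup_eq_left.2 hle] at hc
      exact (hmax M hM).ne_top hc
    obtain ⟨e, he, heM⟩ := SetLike.not_le_iff_exists.1 hlt
    refine ⟨e, heM, fun M' hM' hne => ?_⟩
    simp only [Submodule.mem_iInf] at he
    exact he M' (Finset.mem_erase.2 ⟨hne, hM'⟩)
  choose! a ha b hb hab using h1
  choose! e he he' using h2
  let y := ∑ M ∈ s, e M • a M
  have hy : y ∈ I := Submodule.sum_mem (I : Submodule A K) fun M hM =>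
    Submodule.smul_mem _ _ (ha M hM)
  have hle : spanSingleton A⁰ y * I' ≤ 1 := by
    rw [← hinv]
    exact mul_le_mul_left (spanSingleton_le_iff_mem.2 hy) I'
  obtain ⟨J, hJ⟩ := le_one_iff_exists_coeIdeal.1 hle
  refine ⟨y, J, hJ, ?_⟩
  by_contra hne
  obtain ⟨M, hM, hJM⟩ := Ideal.exists_le_maximal _ hne
  have hMs : M ∈ s := hf.mem_toFinset.2 ⟨hM, le_sup_right.trans hJM⟩
  have hyb : y * b M ∈ (M : FractionalIdeal A⁰ K) := by
    have h3 : y * b M ∈ (J : FractionalIdeal A⁰ K) := by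
      rw [hJ]
      exact mul_mem_mul (mem_spanSingleton_self _ _) (hb M hMs)
    exact (coeIdeal_le_coeIdeal K).2 (le_sup_left.trans hJM) h3
  choose! c hc using fun M' (hM' : M' ∈ s) => hint (ha M' hM') (hb M hMs)
  have hsum : y * b M = algebraMap A K (∑ M' ∈ s, e M' * c M') := by
    rw [map_sum, Finset.sum_mul]
    refine Finset.sum_congr rfl fun M' hM' => ?_
    rw [map_mul, hc M' hM', Algebra.smul_def, mul_assoc]
  have hmemM : ∑ M' ∈ s, e M' * c M' ∈ M := by
    rw [hsum] at hyb
    obtain ⟨d, hd, hd'⟩ := (mem_coeIdeal A⁰).1 hyb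
    rwa [← IsFractionRing.injective A K hd']
  rw [← Finset.add_sum_erase _ _ hMs] at hmemM
  have hrest : ∑ M' ∈ s.erase M, e M' * c M' ∈ M := Ideal.sum_mem _ fun M' hM' =>
    M.mul_mem_right _ (he' M' (Finset.mem_of_mem_erase hM') M hMs (Finset.ne_of_mem_erase hM').symm)
  have hec := (Submodule.add_mem_iff_left M hrest).1 hmemM
  have hcM := (hM.isPrime.mem_or_mem hec).resolve_left (he M hMs)
  apply hab M hMs
  rw [← hc M hMs]
  exact mem_coeIdeal_of_mem _ hcM

/-- Every ideal class of invertible ideals has an integral representative coprime to a given ideal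
contained in only finitely many maximal ideals. -/
lemma exists_coprime_representative {𝔞 : Ideal A} (h𝔞 : 𝔞 ≠ ⊤)
    (hf : {M : Ideal A | M.IsMaximal ∧ 𝔞 ≤ M}.Finite) (c : ClassGroup A) :
    ∃ (J : Ideal A) (U : (FractionalIdeal A⁰ (FractionRing A))ˣ),
      (U : FractionalIdeal A⁰ (FractionRing A)) = J ∧ ClassGroup.mk (FractionRing A) U = c ∧
        J ⊔ 𝔞 = ⊤ := by
  refine ClassGroup.induction (FractionRing A) (fun I => ?_) c
  obtain ⟨y, J, hJ, hJ𝔞⟩ := exists_coprime_multiple hf (Units.inv_mul I)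
  have hy : y ≠ 0 := by
    rintro rfl
    rw [FractionalIdeal.spanSingleton_zero, zero_mul, FractionalIdeal.coeIdeal_eq_zero] at hJ
    rw [hJ, bot_sup_eq] at hJ𝔞
    exact h𝔞 hJ𝔞
  refine ⟨J, I * toPrincipalIdeal A _ (Units.mk0 y hy), ?_, ?_, hJ𝔞⟩
  · rw [hJ, Units.val_mul, coe_toPrincipalIdeal, mul_comm]
    rfl
  · exact (ClassGroup.mk_eq_mk.2 ⟨_, rfl⟩).symm

end Representatives

section Picard

/-! ### The map from the Picard group to the class group -/

variable {R : Type u} [CommRing R] {O : Subring R}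

variable (O) in
/-- The conductor, as an ideal of `O`. -/
abbrev orderConductor : Ideal O := (conductor O).comap (algebraMap O R)

lemma finite_maximal_orderConductor [Finite (R ⧸ conductor O)] :
    {M : Ideal O | M.IsMaximal ∧ orderConductor O ≤ M}.Finite := by
  have : Finite (O ⧸ orderConductor O) := Finite.of_injective
    (Ideal.quotientMap (conductor O) (algebraMap O R) le_rfl) Ideal.quotientMap_injective
  have : Finite (Ideal (O ⧸ orderConductor O)) := Finite.of_injective
    (fun I => (I : Set (O ⧸ orderConductor O))) SetLike.coe_injective
  refine Set.Finite.of_injOn (f := Ideal.map (Ideal.Quotient.mk (orderConductor O)))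
    (fun _ _ => Set.mem_univ _) ?_ Set.finite_univ
  intro M hM N hN h
  have := congrArg (Ideal.comap (Ideal.Quotient.mk (orderConductor O))) h
  simpa [Ideal.comap_map_quotientMk, sup_eq_right.2 hM.2, sup_eq_right.2 hN.2] using this

lemma exists_mem_mul_conductor {J : Ideal O} {z x : R} (hz : z ∈ J.map (algebraMap O R))
    (hx : x ∈ conductor O) : ∃ w ∈ J, ((w : O) : R) = z * x := by
  induction hz using Submodule.span_induction generalizing x with
  | mem z hz =>
    obtain ⟨j, hj, rfl⟩ := hz
    exact ⟨⟨x, mem_of_mem_conductor hx⟩ * j, J.mul_mem_left _ hj, mul_comm x _⟩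
  | zero => exact ⟨0, J.zero_mem, by simp⟩
  | add z z' _ _ h h' =>
    obtain ⟨w, hw, h⟩ := h hx
    obtain ⟨w', hw', h'⟩ := h' hx
    exact ⟨w + w', J.add_mem hw hw', by rw [add_mul, ← h, ← h']; rfl⟩
  | smul r z _ h =>
    obtain ⟨w, hw, h⟩ := h ((conductor O).mul_mem_left r hx)
    exact ⟨w, hw, by rw [h, smul_eq_mul]; ring⟩

/-- Contraction inverts extension on the ideals of `O` coprime to the conductor. -/
lemma comap_map_of_coprime {J : Ideal O} (hJ : J ⊔ orderConductor O = ⊤) :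
    (J.map (algebraMap O R)).comap (algebraMap O R) = J := by
  refine le_antisymm (fun z hz => ?_) Ideal.le_comap_map
  obtain ⟨j, hj, x, hx, hjx⟩ := Submodule.mem_sup.1 ((Ideal.eq_top_iff_one _).1 hJ)
  obtain ⟨w, hw, hwz⟩ := exists_mem_mul_conductor hz hx
  have hz' : z = z * j + w := by
    have : w = z * x := Subtype.ext hwz
    rw [this, ← mul_add, hjx, mul_one]
  rw [hz']
  exact J.add_mem (J.mul_mem_left _ hj) hw

lemma isCoprime_map {J : Ideal O} (hJ : J ⊔ orderConductor O = ⊤) :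
    IsCoprime (J.map (algebraMap O R)) (conductor O) := by
  obtain ⟨j, hj, x, hx, hjx⟩ := Submodule.mem_sup.1 ((Ideal.eq_top_iff_one _).1 hJ)
  exact Ideal.isCoprime_iff_exists.2 ⟨_, Ideal.mem_map_of_mem _ hj, _, hx, by
    rw [← map_one (algebraMap O R), ← hjx, map_add]⟩

lemma exists_add_eq_one {Q : Ideal R} (hQ : IsCoprime Q (conductor O)) :
    ∃ q x : O, (q : R) ∈ Q ∧ (x : R) ∈ conductor O ∧ q + x = 1 := by
  obtain ⟨q, hq, x, hx, hqx⟩ := Ideal.isCoprime_iff_exists.1 hQ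
  have hxO := mem_of_mem_conductor hx
  have hqO : q ∈ O := by
    rw [eq_sub_of_add_eq hqx]
    exact O.sub_mem O.one_mem hxO
  exact ⟨⟨q, hqO⟩, ⟨x, hxO⟩, hq, hx, Subtype.ext hqx⟩

/-- Extension inverts contraction on the ideals of `R` coprime to the conductor. -/
lemma map_comap_of_coprime {Q : Ideal R} (hQ : IsCoprime Q (conductor O)) :
    (Q.comap (algebraMap O R)).map (algebraMap O R) = Q := by
  refine le_antisymm Ideal.map_comap_le fun z hz => ?_
  obtain ⟨q, x, hq, hx, hqx⟩ := exists_add_eq_one hQ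
  have hqx' : (q : R) + x = 1 := congrArg Subtype.val hqx
  have hz' : z = z * q + x * z := by rw [mul_comm (x : R), ← mul_add, hqx', mul_one]
  rw [hz']
  refine Ideal.add_mem _ (Ideal.mul_mem_left _ _ (Ideal.mem_map_of_mem (algebraMap O R) hq)) ?_
  have hxz : (⟨x * z, hx z⟩ : O) ∈ Q.comap (algebraMap O R) := Q.mul_mem_left _ hz
  exact Ideal.mem_map_of_mem (algebraMap O R) hxz

/-- Contraction is multiplicative on the ideals of `R` coprime to the conductor. -/
lemma comap_mul_comap_of_coprime {Q Q' : Ideal R} (hQ : IsCoprime Q (conductor O))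
    (hQ' : IsCoprime Q' (conductor O)) :
    Q.comap (algebraMap O R) * Q'.comap (algebraMap O R) = (Q * Q').comap (algebraMap O R) := by
  have h1 : Q.comap (algebraMap O R) * Q'.comap (algebraMap O R) ⊔ orderConductor O = ⊤ := by
    have key : ∀ {Q : Ideal R}, IsCoprime Q (conductor O) →
        IsCoprime (Q.comap (algebraMap O R)) (orderConductor O) := fun {Q} hQ => by
      obtain ⟨q, x, hq, hx, hqx⟩ := exists_add_eq_one hQ
      exact Ideal.isCoprime_iff_exists.2 ⟨q, hq, x, hx, hqx⟩
    exact Ideal.isCoprime_iff_sup_eq.1 ((key hQ).mul_left (key hQ'))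
  rw [← comap_map_of_coprime h1, Ideal.map_mul, map_comap_of_coprime hQ, map_comap_of_coprime hQ']

lemma comap_span_singleton [Finite (R ⧸ conductor O)] {b : O}
    (hb : (b : R) ∈ regularElements O) :
    (Ideal.span {(b : R)}).comap (algebraMap O R) = Ideal.span {b} := by
  ext z
  rw [Ideal.mem_comap, Ideal.mem_span_singleton, Ideal.mem_span_singleton]
  constructor
  · rintro ⟨r, hr⟩
    have hr' : (b : R) * r ∈ O := hr ▸ z.2
    exact ⟨⟨r, mem_of_mul_mem hb b.2 hr'⟩, Subtype.ext hr⟩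
  · rintro ⟨r, rfl⟩
    exact ⟨r, rfl⟩

lemma orderConductor_ne_top (hO : O ≠ ⊤) : orderConductor O ≠ ⊤ :=
  fun e => conductor_ne_top hO (Ideal.comap_eq_top_iff.1 e)

variable [IsDedekindDomain R] [Finite (R ⧸ conductor O)]

/-- The kernel of `Pic O → Cl R` is the obstruction to regular elements being associated to elements
of `O`. -/
theorem extendedHom_injective (hO : O ≠ ⊤)
    (h : ∀ a ∈ regularElements O, ∃ b ∈ O, Associated a b) :
    Function.Injective (ClassGroup.extendedHom O R) := by
  rw [injective_iff_map_eq_one]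
  intro c hc
  obtain ⟨J, U, hU, rfl, hJ⟩ := exists_coprime_representative (orderConductor_ne_top hO)
    finite_maximal_orderConductor c
  rw [ClassGroup.extendedHom_mk, ClassGroup.mk_eq_one_of_coe_ideal (I' := J.map (algebraMap O R))
    (by
      rw [Units.coe_map, hU]
      exact FractionalIdeal.extendedHom_coeIdeal_eq_map (FractionRing R) R J)] at hc
  obtain ⟨a, -, ha⟩ := hc
  have hareg : a ∈ regularElements O := mem_regularElements_iff.2 (ha ▸ isCoprime_map hJ)
  obtain ⟨b, hb, hab⟩ := h a hareg
  rw [Ideal.span_singleton_eq_span_singleton.2 hab] at ha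
  have hbreg : b ∈ regularElements O := mem_regularElements_iff.2 (ha ▸ isCoprime_map hJ)
  rw [ClassGroup.mk_eq_one_of_coe_ideal hU]
  refine ⟨⟨b, hb⟩, fun e => ne_zero_of_mem_regularElements hO hbreg (congrArg Subtype.val e), ?_⟩
  rw [← comap_map_of_coprime hJ, ha]
  exact comap_span_singleton (b := ⟨b, hb⟩) hbreg

/-- An ideal `Q` of `R` coprime to the conductor is extended from `Q ∩ O`, which is invertible since
some power of `Q` is generated by an element of `O`. -/
theorem extendedHom_surjective (hO : O ≠ ⊤) (hR : IsMulTorsion (ClassGroup R))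
    (hprime : Function.Surjective (primeClass (O := O))) :
    Function.Surjective (ClassGroup.extendedHom O R) := by
  intro c
  obtain ⟨P, rfl⟩ := hprime c
  obtain ⟨n, hn, hPn⟩ := (hR (primeClass P)).exists_pow_eq_one
  rw [primeClass, ← map_pow] at hPn
  obtain ⟨a, ha⟩ := (ClassGroup.mk0_eq_one_iff (pow_mem (mem_nonZeroDivisors_of_ne_zero P.2.1) n)).1
    hPn
  have ha : P.1 ^ n = Ideal.span {a} := ha
  have hareg : a ∈ regularElements O := mem_regularElements_iff.2 (ha ▸ P.2.2.2.pow_left)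
  obtain ⟨m, hm, hb⟩ := exists_pow_mem hareg
  have hbreg : a ^ m ∈ regularElements O := pow_mem hareg m
  obtain ⟨N, hN⟩ := Nat.exists_eq_succ_of_ne_zero (Nat.mul_pos hn hm).ne'
  have hPb : P.1 * P.1 ^ N = Ideal.span {a ^ m} := by
    rw [← pow_succ', ← Nat.succ_eq_add_one, ← hN, pow_mul, ha, Ideal.span_singleton_pow]
  set I := P.1.comap (algebraMap O R)
  have hI : I * (P.1 ^ N).comap (algebraMap O R) = Ideal.span {⟨a ^ m, hb⟩} := by
    rw [comap_mul_comap_of_coprime P.2.2.2 P.2.2.2.pow_left, hPb]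
    exact comap_span_singleton (b := ⟨a ^ m, hb⟩) hbreg
  have hunit : IsUnit (I : FractionalIdeal O⁰ (FractionRing O)) := by
    apply isUnit_of_mul_isUnit_left
      (y := (((P.1 ^ N).comap (algebraMap O R) : Ideal O) : FractionalIdeal O⁰ (FractionRing O)))
    rw [← FractionalIdeal.coeIdeal_mul, hI, FractionalIdeal.coeIdeal_span_singleton]
    have h0 : algebraMap O (FractionRing O) ⟨a ^ m, hb⟩ ≠ 0 := by
      rw [Ne, FaithfulSMul.algebraMap_eq_zero_iff]
      exact fun e => ne_zero_of_mem_regularElements hO hbreg (congrArg Subtype.val e)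
    exact ⟨toPrincipalIdeal O _ (Units.mk0 _ h0), by rw [coe_toPrincipalIdeal]; rfl⟩
  obtain ⟨U, hU⟩ := hunit
  refine ⟨ClassGroup.mk _ U, ?_⟩
  rw [ClassGroup.extendedHom_mk, primeClass, ← ClassGroup.mk_mk0 (FractionRing R),
    ClassGroup.mk_eq_mk_of_coe_ideal (I' := P.1) (J' := P.1) ?_ (FractionalIdeal.coe_mk0 _ _)]
  · exact ⟨1, 1, one_ne_zero, one_ne_zero, rfl⟩
  · rw [Units.coe_map, hU]
    refine (FractionalIdeal.extendedHom_coeIdeal_eq_map (FractionRing R) R I).trans ?_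
    rw [map_comap_of_coprime P.2.2.2]

end Picard

end TransferKrull

/-- `ClassGroup O` is the group of invertible fractional ideals of `O` modulo the principal ones,
that is, `Pic(O)`, and `ClassGroup.extendedHom O R` is the canonical map `[I] ↦ [I R]`. -/
theorem proposition3p4 {R : Type u} [CommRing R] [IsDedekindDomain R]
    (hR : IsMulTorsion (ClassGroup R))
    (O : Subring R) (hO : TransferKrull.IsOrder O) (hproper : O ≠ ⊤)
    (hfin : Finite (R ⧸ TransferKrull.conductor O))
    (hprime : ∀ c : ClassGroup R, ∃ P : (Ideal R)⁰, (P : Ideal R).IsPrime ∧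
      IsCoprime (P : Ideal R) (TransferKrull.conductor O) ∧ ClassGroup.mk0 P = c)
    (hTK : TransferKrull.IsTransferKrull.{u, v} O⁰)
    (hcard : Nat.card (ClassGroup R) ≠ 2) :
    Nonempty (CommRing.Pic O ≃* ClassGroup R) ∧
    Function.Bijective (ClassGroup.extendedHom O R) ∧
    ∀ a ∈ TransferKrull.regularElements O, ∃ b ∈ O, Associated a b := by
  have hsurj : Function.Surjective (TransferKrull.primeClass (O := O)) := by
    intro c
    obtain ⟨P, hP, hPf, hc⟩ := hprime c
    exact ⟨⟨P, nonZeroDivisors.ne_zero P.2, hP, hPf⟩, hc⟩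
  -- A finite domain is a field, which has no nonzero prime ideals.
  have hf : TransferKrull.conductor O ≠ ⊥ := by
    intro h
    rw [h] at hfin
    have : Finite R := Finite.of_equiv _ (RingEquiv.quotientBot R).toEquiv
    obtain ⟨P, hP, -, -⟩ := hprime 1
    have hfield := Finite.isField_of_domain R
    let _ := hfield.toField
    rcases Ideal.eq_bot_or_top (P : Ideal R) with h | h
    · exact nonZeroDivisors.ne_zero P.2 h
    · exact hP.ne_top h
  have hreg : ∀ a ∈ TransferKrull.regularElements O, ∃ b ∈ O, Associated a b := fun a ha =>
    TransferKrull.exists_associated_mem hproper hf hR hsurj hTK hcard ha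
  have hbij : Function.Bijective (ClassGroup.extendedHom O R) :=
    ⟨TransferKrull.extendedHom_injective hproper hreg,
      TransferKrull.extendedHom_surjective hproper hR hsurj⟩
  exact ⟨⟨(ClassGroup.equivPic O).symm.trans (MulEquiv.ofBijective _ hbij)⟩, hbij, hreg⟩
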